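/- Let $n$ and $r$ be positive integers. Write a permutation $\pi\in\mathfrak S_n$ in one-line notation as $\pi_1\pi_2\cdots\pi_n$, and let $\pi^{-1}$ be its inverse. Define - $\mathrm{Des}(\pi)=\{i\in[n-1]:\pi_i>\pi_{i+1}\}$, $\mathrm{des}(\pi)=|\mathrm{Des}(\pi)|$ and $\mathrm{maj}(\pi)=\sum_{i\in\mathrm{Des}(\pi)}i$; - $\mathrm{inv}(\pi)=|\{(i,j):i<j,\ \pi_i>\pi_j\}|$; - $\mathrm{inv}_r(\pi)=|\{(i,j):i<j<i+r,\ \pi_i>\pi_j\}|+\sum_{i\le n-r,\ \pi_i>\pi_{i+r}}i$; - $\mathrm{lrmax}(\pi)=|\{i:\pi_j<\pi_i\text{ for all }j<i\}|$, the number of left-to-right maxima; - $\mathrm{mak}(\pi)=\sum_{i\in\mathrm{Des}(\pi)}\pi_{i+1}+\sum_{i=1}^n e_i$, where $e_i$ is the number of maximal contiguous decreasing subwords $\pi_a\pi_{a+1}\cdots\pi_b$ of $\pi$ with $i<a<b$ and $\pi_a\ge\pi_i>\pi_b$; - $\mathrm{imaj}(\pi)=\mathrm{maj}(\pi^{-1})$,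 $\mathrm{imak}(\pi)=\mathrm{mak}(\pi^{-1})$ and $\mathrm{iinv}_r(\pi)=\mathrm{inv}_r(\pi^{-1})$. Statistics are equidistributed on a finite set if each value is taken equally often by each of them on that set. Then: 1. The triples $(\mathrm{lrmax},\mathrm{des},\mathrm{inv})$, $(\mathrm{lrmax},\mathrm{des},\mathrm{imaj})$, $(\mathrm{lrmax},\mathrm{des},\mathrm{imak})$ and $(\mathrm{lrmax},\mathrm{des},\mathrm{iinv}_r)$ are equidistributed on $\mathfrak S_n$. 2. For every $S\subseteq[n-1]$, the pairs $(\mathrm{inv},\mathrm{lrmax})$, $(\mathrm{imaj},\mathrm{lrmax})$, $(\mathrm{imak},\mathrm{lrmax})$ and $(\mathrm{iinv}_r,\mathrm{lrmax})$ are equidistributed on $\{\pi\in\mathfrak S_n:\mathrm{Des}(\pi)=S\}$, and also on $\{\pi\in\mathfrak S_n:\mathrm{Des}(\pi)\subseteq S\}$. -/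

import Mathlib

/-! Statistics on words and permutations. A word `w₁ w₂ … wₙ` is a function `Fin n → ℕ`; the index
`i : Fin n` stands for the position `i + 1`, so positions are counted from `1` to `n`. -/

namespace WordStat

variable {n : ℕ}

/-- The position of the index `i` is a descent of `w`: there is a next letter, and it is smaller. -/
def IsDescent (w : Fin n → ℕ) (i : Fin n) : Prop :=
  ∃ j : Fin n, (j : ℕ) = i + 1 ∧ w j < w i

instance (w : Fin n → ℕ) : DecidablePred (IsDescent w) := fun i =>
  inferInstanceAs (Decidable (∃ j : Fin n, (j : ℕ) = i + 1 ∧ w j < w i))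

/-- The set of descents of `w`, a subset of `{1, …, n - 1}`. -/
def Des (w : Fin n → ℕ) : Finset ℕ :=
  (Finset.univ.filter fun i : Fin n => IsDescent w i).image fun i : Fin n => (i : ℕ) + 1

/-- The number of descents. -/
def des (w : Fin n → ℕ) : ℕ := (Des w).card

/-- The number of inversions. -/
def inv (w : Fin n → ℕ) : ℕ :=
  (Finset.univ.filter fun p : Fin n × Fin n => p.1 < p.2 ∧ w p.2 < w p.1).card

/-- The major index: the sum of the descents. -/
def maj (w : Fin n → ℕ) : ℕ := ∑ i ∈ Des w, i

/-- Kadell's statistic: the number of pairs of positions `i < j < i + r` with `wᵢ > wⱼ`, plus the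
sum of the positions `i` (counted from `1`) with `i + r ≤ n` and `wᵢ > wᵢ₊ᵣ`. -/
def invr (r : ℕ) (w : Fin n → ℕ) : ℕ :=
  (Finset.univ.filter fun p : Fin n × Fin n =>
      p.1 < p.2 ∧ (p.2 : ℕ) < p.1 + r ∧ w p.2 < w p.1).card +
    ∑ i ∈ Finset.univ.filter (fun i : Fin n => ∃ j : Fin n, (j : ℕ) = i + r ∧ w j < w i),
      ((i : ℕ) + 1)

/-- The height of the letter `a` in `w`: one more than the number of letters of `w` that are
strictly smaller than `a`. -/
def height (w : Fin n → ℕ) (a : ℕ) : ℕ :=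
  1 + (Finset.univ.filter fun j : Fin n => w j < a).card

/-- The value of the `i`-th letter of `w`: its height plus the number of letters to its left that
are equal to it. -/
def value (w : Fin n → ℕ) (i : Fin n) : ℕ :=
  height w (w i) + (Finset.univ.filter fun j : Fin n => j < i ∧ w j = w i).card

/-- The descent bottoms sum: the sum of the values of the descent bottoms. -/
def Dbot (w : Fin n → ℕ) : ℕ :=
  ∑ j ∈ Finset.univ.filter (fun j : Fin n => ∃ i : Fin n, (j : ℕ) = i + 1 ∧ w j < w i), value w j

/-- The letters at the indices `a, a + 1, …, b` form a descent block of `w`, i.e. a maximal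
contiguous strictly decreasing subword. -/
def IsDescentBlock (w : Fin n → ℕ) (a b : Fin n) : Prop :=
  a ≤ b ∧ (∀ k : Fin n, a ≤ k → k < b → IsDescent w k) ∧
    (∀ k : Fin n, (k : ℕ) + 1 = a → ¬ IsDescent w k) ∧ ¬ IsDescent w b

instance (w : Fin n → ℕ) (a b : Fin n) : Decidable (IsDescentBlock w a b) :=
  inferInstanceAs (Decidable (a ≤ b ∧ (∀ k : Fin n, a ≤ k → k < b → IsDescent w k) ∧
    (∀ k : Fin n, (k : ℕ) + 1 = a → ¬ IsDescent w k) ∧ ¬ IsDescent w b))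

/-- The embracing number of the `i`-th letter: the number of proper descent blocks (those with at
least two letters) lying strictly to the right of the `i`-th letter, with first letter (closer)
`≥ wᵢ` and last letter (opener) `< wᵢ`. -/
def embracing (w : Fin n → ℕ) (i : Fin n) : ℕ :=
  (Finset.univ.filter fun B : Fin n × Fin n =>
    IsDescentBlock w B.1 B.2 ∧ B.1 < B.2 ∧ i < B.1 ∧ w i ≤ w B.1 ∧ w B.2 < w i).card

/-- The embracing sum. -/
def Res (w : Fin n → ℕ) : ℕ := ∑ i : Fin n, embracing w i

/-- The Foata–Zeilberger statistic, in the form of Clarke, Steingrímsson and Zeng. -/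
def mak (w : Fin n → ℕ) : ℕ := Dbot w + Res w

/-- The positions (as indices in `Fin n`) of the left-to-right maxima. -/
def PLrmax (w : Fin n → ℕ) : Finset (Fin n) :=
  Finset.univ.filter fun i : Fin n => ∀ j : Fin n, j < i → w j < w i

/-- The number of left-to-right maxima. -/
def lrmax (w : Fin n → ℕ) : ℕ := (PLrmax w).card

/-- The one-line notation `π₁ π₂ … πₙ`, a word with letters `1, …, n`, of a permutation. -/
def oneLine (π : Equiv.Perm (Fin n)) : Fin n → ℕ := fun i => (π i : ℕ) + 1

/-- For a statistic `st`, the statistic `ist` on permutations given by `ist(π) = st(π⁻¹)`. -/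
def istat (st : (Fin n → ℕ) → ℕ) (π : Equiv.Perm (Fin n)) : ℕ := st (oneLine π⁻¹)

/-- The permutations whose descent set is equal to `S`. -/
def permDesEq (n : ℕ) (S : Finset ℕ) : Finset (Equiv.Perm (Fin n)) :=
  Finset.univ.filter fun π => Des (oneLine π) = S

/-- The permutations whose descent set is contained in `S`. -/
def permDesSubset (n : ℕ) (S : Finset ℕ) : Finset (Equiv.Perm (Fin n)) :=
  Finset.univ.filter fun π => Des (oneLine π) ⊆ S

/-- The (vector-valued) statistics `f` and `g` are equidistributed on the finite set `A`: each value
is attained equally often by `f` and by `g` on `A`. -/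
def Equidistributed {α β : Type} [DecidableEq β] (A : Finset α) (f g : α → β) : Prop :=
  ∀ b : β, (A.filter fun a => f a = b).card = (A.filter fun a => g a = b).card

end WordStat

/-! All statistics are transported to `σ = π⁻¹`. There `lrmax π` is the number of right-to-left
minima of `σ`, `inv π = inv σ`, and `Des π ⊆ S` says that `v + 1` stands to the left of `v` in `σ`
only if `v ∈ S` (`InvDesSubset`). So it has to be shown that `(inv, rlmin)`, `(mak, rlmin)` and
`(invr r, rlmin)` have the same distribution on the `σ` with `InvDesSubset S`, for every `S`; the
sets `{Des = S}` follow by induction on `S`, the triples by summation over `S`, and `maj` is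
`invr 1`.

For `invr r`, Kadell's variant `kadell` of Foata's second fundamental transformation works: when a
letter `x` is appended, Foata's rotation is applied to all but the last `r - 1` letters. The
rotation preserves the relative order of the letters below `x` and that of the letters above `x`.
Hence the map preserves the right-to-left minima and the relative order of `v` and `v + 1`.

For `mak`, permutations are built by inserting `1, 2, …, N` in turn, and a descent block whose
larger letters are still to come is recorded by a mark on its first letter, as if a letter `∞` stood
in front of it. Each insertion of the letter `N` takes place at the end or in front of a marked
letter, which keeps or loses its mark, and `N` itself may be marked. If `N` then has `e` marks on
its right, `mak` has increased by `e`, and by another `N` if `N` is marked; there is a new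
right-to-left minimum exactly if `N` comes last. The new letter has to be placed to the right of the
previous one unless the previous one belongs to `S`, so the number of marks to the right of `N` is
recorded as well. The result (`markedPermSum_eq`) is that `mak` is distributed like `inv`, and that
the marks behave like a set `A ⊆ {1, …, N}` of weight `q ^ ∑ A` that is independent of the
permutation, where the marks to the right of `N` correspond to the `a ∈ A` with `a ≤ p`, for `p` the
number of letters to the right of `N`. The induction step is the identity
`markedSum_insertMarked`. The marked permutations without marks give the claim for `mak`. -/

namespace WordStat

/-! ### Sums over marked sets -/

section MarkedSets

variable {R : Type*} [CommRing R]

/-- The sum of `q ^ (∑ a ∈ A, a) * Φ |A| #{a ∈ A | a ≤ p}` over all `A ⊆ {1, …, N}`. The first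
argument of `Φ` is an integer so that it can be lowered without truncation. -/
def markedSum (q : R) (p : ℕ) : ℕ → (ℤ → ℕ → R) → R
  | 0, Φ => Φ 0 0
  | N + 1, Φ => markedSum q p N Φ +
      q ^ (N + 1) * markedSum q p N fun k j => Φ (k + 1) (if N + 1 ≤ p then j + 1 else j)

/-- The weight `q ^ e`, multiplied by `t` if `e = 0`. -/
def stepWeight (q t : R) (e : ℕ) : R := q ^ e * if e = 0 then t else 1

/-- The effect on a test function `Φ` of inserting a new largest letter into a marked permutation
with `k` marks, `j` of which lie in the range that is open for the insertion: either all marks stay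
and the new letter has `e ≤ j` of them on its right, or the letter after it loses its mark and the
new letter has `e < j` marks on its right. A mark on the new letter itself is not taken into account
here. -/
def insertMarked (q t : R) (Φ : ℤ → ℕ → R) (k : ℤ) (j : ℕ) : R :=
  ∑ e ∈ Finset.range (j + 1), stepWeight q t e * Φ k e +
    ∑ e ∈ Finset.range j, q ^ e * Φ (k - 1) e

lemma markedSum_add (q : R) (p N : ℕ) (Φ Ψ : ℤ → ℕ → R) :
    markedSum q p N (fun k j => Φ k j + Ψ k j) = markedSum q p N Φ + markedSum q p N Ψ := by
  induction N generalizing Φ Ψ with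
  | zero => rfl
  | succ N ih => simp only [markedSum, ih]; ring

lemma markedSum_mul (q : R) (p N : ℕ) (c : R) (Φ : ℤ → ℕ → R) :
    markedSum q p N (fun k j => c * Φ k j) = c * markedSum q p N Φ := by
  induction N generalizing Φ with
  | zero => rfl
  | succ N ih => simp only [markedSum, ih]; ring

lemma markedSum_succ_of_le (q : R) {p N : ℕ} (h : p ≤ N) (Φ : ℤ → ℕ → R) :
    markedSum q p (N + 1) Φ =
      markedSum q p N Φ + q ^ (N + 1) * markedSum q p N fun k j => Φ (k + 1) j := by
  simp [markedSum, Nat.not_le.2 (Nat.lt_succ_of_le h)]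

lemma markedSum_congr_of_le (q : R) {p p' N : ℕ} (h : N ≤ p) (h' : N ≤ p') (Φ : ℤ → ℕ → R) :
    markedSum q p N Φ = markedSum q p' N Φ := by
  induction N generalizing Φ with
  | zero => rfl
  | succ N ih =>
    simp only [markedSum, if_pos h, if_pos h']
    rw [ih (by omega) (by omega), ih (by omega) (by omega)]

lemma markedSum_const (q : R) (p p' N : ℕ) (χ : ℤ → R) :
    markedSum q p N (fun k _ => χ k) = markedSum q p' N fun k _ => χ k := by
  induction N generalizing χ with
  | zero => rfl
  | succ N ih => rw [markedSum, markedSum, ih, ih fun k => χ (k + 1)]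

lemma markedSum_self_succ (q : R) (N : ℕ) (Φ : ℤ → ℕ → R) :
    markedSum q (N + 1) (N + 1) Φ =
      markedSum q N N Φ + q ^ (N + 1) * markedSum q N N fun k j => Φ (k + 1) (j + 1) := by
  simp only [markedSum, le_refl, if_true]
  rw [markedSum_congr_of_le q (Nat.le_succ N) le_rfl,
    markedSum_congr_of_le q (Nat.le_succ N) le_rfl]

/-- Only the size of the marked set is seen if the bound `p` is at least `N`. -/
lemma markedSum_self_congr (q : R) (N : ℕ) (Φ Ψ : ℤ → ℕ → R) (h : ∀ k : ℕ, Φ k k = Ψ k k) :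
    markedSum q N N Φ = markedSum q N N Ψ := by
  induction N generalizing Φ Ψ with
  | zero => exact h 0
  | succ N ih =>
    have h' : ∀ k : ℕ, Φ ((k : ℤ) + 1) (k + 1) = Ψ ((k : ℤ) + 1) (k + 1) := fun k =>
      by simpa using h (k + 1)
    rw [markedSum_self_succ, markedSum_self_succ, ih Φ Ψ h,
      ih (fun k j => Φ (k + 1) (j + 1)) (fun k j => Ψ (k + 1) (j + 1)) h']

/-- Sets `A ⊆ {1, …, N + 1}` arise from sets `B ⊆ {1, …, N}` by shifting `B` up by one and possibly
adding the element `1`. -/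
lemma markedSum_shift (q : R) (N : ℕ) (Φ : ℤ → ℕ → R) :
    markedSum q N N (fun k j => q ^ j * (q * Φ (k + 1) (j + 1) + Φ k j)) =
      markedSum q (N + 1) (N + 1) Φ := by
  induction N generalizing Φ with
  | zero => simp [markedSum]; ring
  | succ N ih =>
    rw [markedSum_self_succ, ih, markedSum_self_succ q (N + 1), ← ih fun k j => Φ (k + 1) (j + 1),
      pow_succ q (N + 1), mul_assoc, ← markedSum_mul q N N q]
    have h : ∀ (k : ℤ) (j : ℕ),
        q ^ (j + 1) * (q * Φ (k + 1 + 1) (j + 1 + 1) + Φ (k + 1) (j + 1)) =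
          q * (q ^ j * (q * Φ (k + 1 + 1) (j + 1 + 1) + Φ (k + 1) (j + 1))) := fun k j => by ring
    simp only [h]

lemma insertMarked_succ (q t : R) (Φ : ℤ → ℕ → R) (k : ℤ) (j : ℕ) :
    insertMarked q t Φ (k + 1) (j + 1) = insertMarked q t (fun k j => Φ (k + 1) j) k j +
      q ^ j * (q * Φ (k + 1) (j + 1) + Φ k j) := by
  simp only [insertMarked, Finset.sum_range_succ _ (j + 1), Finset.sum_range_succ _ j]
  simp [stepWeight]
  ring

lemma insertMarked_shift (q t : R) (Φ : ℤ → ℕ → R) (k : ℤ) (j : ℕ) :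
    insertMarked q t Φ (k + 1) j = insertMarked q t (fun k j => Φ (k + 1) j) k j := by
  simp [insertMarked]

lemma markedSum_self_insertMarked (q t : R) (N : ℕ) (Φ : ℤ → ℕ → R) :
    markedSum q N N (insertMarked q t Φ) =
      ∑ p ∈ Finset.range (N + 1), stepWeight q t p * markedSum q p N Φ := by
  induction N generalizing Φ with
  | zero => simp [markedSum, insertMarked]
  | succ N ih =>
    rw [markedSum_self_succ, Finset.sum_range_succ]
    simp only [insertMarked_succ]
    rw [markedSum_add, markedSum_shift, ih, ih]
    have h : ∀ p ∈ Finset.range (N + 1), stepWeight q t p * markedSum q p (N + 1) Φ =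
        stepWeight q t p * markedSum q p N Φ +
          q ^ (N + 1) * (stepWeight q t p * markedSum q p N fun k j => Φ (k + 1) j) := by
      intro p hp
      rw [markedSum_succ_of_le q (by simpa [Nat.lt_succ_iff] using hp)]
      ring
    rw [Finset.sum_congr rfl h, Finset.sum_add_distrib, ← Finset.mul_sum]
    simp [stepWeight]
    ring

/-- Inserting a new largest letter into a marked permutation, with `P` prescribing the room for the
insertion, has the same effect on the sums over marked sets as choosing the number `p ≤ P` of
inversions that the new letter creates. -/
lemma markedSum_insertMarked (q t : R) {P N : ℕ} (h : P ≤ N) (Φ : ℤ → ℕ → R) :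
    markedSum q P N (insertMarked q t Φ) =
      ∑ p ∈ Finset.range (P + 1), stepWeight q t p * markedSum q p N Φ := by
  induction N, h using Nat.le_induction generalizing Φ with
  | base => exact markedSum_self_insertMarked q t P Φ
  | succ N hN ih =>
    rw [markedSum_succ_of_le q hN]
    simp only [insertMarked_shift]
    rw [ih, ih, Finset.mul_sum, ← Finset.sum_add_distrib]
    refine Finset.sum_congr rfl fun p hp => ?_
    rw [markedSum_succ_of_le q (by have := Finset.mem_range.1 hp; omega)]
    ring

end MarkedSets

/-! ### Statistics on lists -/

/-- The part of a list that follows the first entry with key `m`. -/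
def after {α : Type*} (key : α → ℕ) (m : ℕ) : List α → List α
  | [] => []
  | b :: c => if key b = m then c else after key m c

/-- The number of inversions of a list. -/
def listInv : List ℕ → ℕ
  | [] => 0
  | x :: l => l.countP (· < x) + listInv l

/-- The number of right-to-left minima of a list. -/
def rlmin : List ℕ → ℕ
  | [] => 0
  | x :: l => (if ∀ y ∈ l, x < y then 1 else 0) + rlmin l

/-- The letter `v + 1` stands to the left of `v` in `l` only if `v ∈ S`, for `1 ≤ v < N`. For a
permutation `l` of `1, …, N` this says that the descent set of the inverse is contained in `S`. -/
def InvDesSubset (S : Finset ℕ) (N : ℕ) (l : List ℕ) : Prop :=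
  ∀ v, 1 ≤ v → v < N → v ∉ S → [v, v + 1].Sublist l

lemma sublist_iff_sublist_filter {α : Type*} (p : α → Bool) {a l : List α} (h : ∀ x ∈ a, p x) :
    a.Sublist l ↔ a.Sublist (l.filter p) := by
  refine ⟨fun H => ?_, fun H => H.trans List.filter_sublist⟩
  have := H.filter p
  rwa [List.filter_eq_self.2 h] at this

lemma invDesSubset_succ {S : Finset ℕ} {N : ℕ} {l d : List ℕ}
    (h : d.filter (· ≠ N + 1) = l) :
    InvDesSubset S (N + 1) d ↔
      InvDesSubset S N l ∧ (1 ≤ N ∧ N ∉ S → [N, N + 1].Sublist d) := by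
  have key : ∀ v, v < N → ([v, v + 1].Sublist d ↔ [v, v + 1].Sublist l) := fun v hv => by
    rw [← h]
    exact sublist_iff_sublist_filter _ (by simp; omega)
  refine ⟨fun H => ⟨fun v h1 h2 h3 => (key v h2).1 (H v h1 (by omega) h3),
    fun h1 => H N h1.1 (by omega) h1.2⟩, fun H v h1 h2 h3 => ?_⟩
  rcases Nat.lt_succ_iff_lt_or_eq.1 h2 with h4 | rfl
  · exact (key v h4).2 (H.1 v h1 h4 h3)
  · exact H.2 ⟨h1, h3⟩

/-! ### Marked permutations -/

/-- A marked word is a list of letters with marks; a marked letter is thought of as being preceded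
by a letter `∞`, so that it is a descent bottom. The lists `insertions N c` are those obtained by
inserting the letter `N`, marked or not, at the end, or in front of a marked letter, which keeps its
mark or loses it. -/
def insertions (N : ℕ) : List (ℕ × Bool) → List (List (ℕ × Bool))
  | [] => [[(N, true)], [(N, false)]]
  | (b, false) :: c => (insertions N c).map ((b, false) :: ·)
  | (b, true) :: c =>
      [(N, true) :: (b, true) :: c, (N, false) :: (b, true) :: c,
        (N, true) :: (b, false) :: c, (N, false) :: (b, false) :: c] ++
      (insertions N c).map ((b, true) :: ·)

/-- The number of marked letters. -/
def numMarks (c : List (ℕ × Bool)) : ℕ := c.countP (·.2)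

/-- Whether the first occurrence of the letter `N` is marked. -/
def markOf (N : ℕ) : List (ℕ × Bool) → Bool
  | [] => false
  | (b, f) :: c => if b = N then f else markOf N c

/-- The number of descents `x y` of a marked word with `x ≥ z > y`, if the word is preceded by the
letter `p`; a marked letter `y` forms a descent `∞ y`. -/
def embrace (z : ℕ) : ℕ → List (ℕ × Bool) → ℕ
  | _, [] => 0
  | p, (b, f) :: c => (if (f = true ∨ z ≤ p) ∧ b < z then 1 else 0) + embrace z b c

/-- The statistic `mak` for a marked word preceded by the letter `p`: the sum of the descent bottoms
and of the embracing numbers. -/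
def markedMak : ℕ → List (ℕ × Bool) → ℕ
  | _, [] => 0
  | p, (b, f) :: c => (if f = true ∨ b < p then b else 0) + embrace b 0 c + markedMak b c

/-- Case analysis, with induction on the tail, for the pairs `d ∈ insertions N c`. -/
lemma insertions_cases {N : ℕ} {P : List (ℕ × Bool) → List (ℕ × Bool) → Prop}
    (nil : ∀ g, P [] [(N, g)])
    (head : ∀ g f b c, P ((b, true) :: c) ((N, g) :: (b, f) :: c))
    (tail : ∀ b f c d, d ∈ insertions N c → P c d → P ((b, f) :: c) ((b, f) :: d)) :
    ∀ c d, d ∈ insertions N c → P c d := by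
  intro c
  induction c with
  | nil =>
    intro d hd
    simp only [insertions, List.mem_cons, List.not_mem_nil, or_false] at hd
    rcases hd with rfl | rfl <;> exact nil _
  | cons x c ih =>
    obtain ⟨b, f⟩ := x
    intro d hd
    cases f
    · simp only [insertions, List.mem_map] at hd
      obtain ⟨d, hd, rfl⟩ := hd
      exact tail _ _ _ _ hd (ih d hd)
    · simp only [insertions, List.mem_map, List.mem_append, List.mem_cons, List.not_mem_nil,
        or_false] at hd
      rcases hd with (rfl | rfl | rfl | rfl) | ⟨d, hd, rfl⟩
      iterate 4 exact head _ _ _ _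
      exact tail _ _ _ _ hd (ih d hd)

lemma perm_of_mem_insertions {N : ℕ} {c d : List (ℕ × Bool)} (h : d ∈ insertions N c) :
    (d.map Prod.fst).Perm (N :: c.map Prod.fst) := by
  suffices H : ∀ c d, d ∈ insertions N c → (d.map Prod.fst).Perm (N :: c.map Prod.fst) from H c d h
  refine insertions_cases (fun g => .refl _) (fun g f b c => .refl _) fun b f c d _ h => ?_
  simpa using (h.cons b).trans (.swap _ _ _)

lemma filter_of_mem_insertions {N : ℕ} {c d : List (ℕ × Bool)} (h : d ∈ insertions N c)
    (hN : N ∉ c.map Prod.fst) :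
    (d.map Prod.fst).filter (· ≠ N) = c.map Prod.fst := by
  suffices H : ∀ c d, d ∈ insertions N c → N ∉ c.map Prod.fst →
      (d.map Prod.fst).filter (· ≠ N) = c.map Prod.fst from H c d h hN
  refine insertions_cases (fun g => by simp) (fun g f b c hN => ?_) fun b f c d _ h hN => ?_
  · rw [List.map_cons, List.filter_cons_of_neg (by simp), List.filter_eq_self.2]
    · simp
    · intro x hx
      simp only [List.map_cons, List.mem_cons] at hx hN
      grind
  · simp only [List.map_cons, List.mem_cons, not_or] at hN
    rw [List.map_cons, List.filter_cons_of_pos (by simpa using Ne.symm hN.1), h hN.2, List.map_cons]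

/-- Deletes the letter `N` and marks the letter that follows it. This undoes every insertion of `N`,
since a letter in front of which `N` is inserted was marked before. -/
def deleteMark (N : ℕ) : List (ℕ × Bool) → List (ℕ × Bool)
  | [] => []
  | (b, f) :: d => if b = N then
      d.modifyHead fun a => (a.1, true)
    else (b, f) :: deleteMark N d

lemma deleteMark_of_mem_insertions {N : ℕ} {c d : List (ℕ × Bool)} (h : d ∈ insertions N c)
    (hN : N ∉ c.map Prod.fst) : deleteMark N d = c := by
  suffices H : ∀ c d, d ∈ insertions N c → N ∉ c.map Prod.fst → deleteMark N d = c from H c d h hN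
  refine insertions_cases (fun g => by simp [deleteMark]) (fun g f b c hN => by simp [deleteMark])
    fun b f c d _ h hN => ?_
  simp only [List.map_cons, List.mem_cons, not_or] at hN
  rw [deleteMark, if_neg (Ne.symm hN.1), h hN.2]

lemma mem_insertions_deleteMark {N : ℕ} {d : List (ℕ × Bool)} (h : N ∈ d.map Prod.fst) :
    d ∈ insertions N (deleteMark N d) := by
  induction d with
  | nil => simp at h
  | cons x d ih =>
    obtain ⟨b, f⟩ := x
    rw [deleteMark]
    split_ifs with hb
    · subst hb
      rcases d with _ | ⟨⟨a, g⟩, d⟩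
      · cases f <;> simp [insertions]
      · cases f <;> cases g <;> simp [insertions]
    · have h' := ih (by simpa [Ne.symm hb] using h)
      cases f <;> simp [insertions, h']

lemma nodup_insertions {N : ℕ} {c : List (ℕ × Bool)} (hN : N ∉ c.map Prod.fst) :
    (insertions N c).Nodup := by
  induction c with
  | nil => simp [insertions]
  | cons x c ih =>
    obtain ⟨b, f⟩ := x
    simp only [List.map_cons, List.mem_cons, not_or] at hN
    have h := (ih hN.2).map (f := ((b, f) :: ·)) (List.cons_injective)
    cases f
    · exact h
    · rw [insertions, List.nodup_append]
      refine ⟨by simp, h, ?_⟩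
      rintro x hx y hy rfl
      obtain ⟨y, -, rfl⟩ := List.mem_map.1 hy
      simp [Ne.symm hN.1] at hx

/-- The marked permutations of `1, …, N`; every word with these letters and arbitrary marks occurs
exactly once, see `mem_markedPerms` and `nodup_markedPerms`. -/
def markedPerms : ℕ → List (List (ℕ × Bool))
  | 0 => [[]]
  | N + 1 => (markedPerms N).flatMap (insertions (N + 1))

/-- The list `N, …, 2, 1`. -/
def descList : ℕ → List ℕ
  | 0 => []
  | N + 1 => (N + 1) :: descList N

lemma mem_descList {N x : ℕ} : x ∈ descList N ↔ 1 ≤ x ∧ x ≤ N := by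
  induction N with
  | zero => simp [descList]; omega
  | succ N ih => simp [descList, ih]; omega

lemma nodup_descList (N : ℕ) : (descList N).Nodup := by
  induction N with
  | zero => simp [descList]
  | succ N ih => simp [descList, ih, mem_descList]

lemma length_descList (N : ℕ) : (descList N).length = N := by
  induction N with
  | zero => rfl
  | succ N ih => simp [descList, ih]

lemma mem_markedPerms {N : ℕ} {d : List (ℕ × Bool)} :
    d ∈ markedPerms N ↔ (d.map Prod.fst).Perm (descList N) := by
  induction N generalizing d with
  | zero => simp [markedPerms, descList]
  | succ N ih =>
    simp only [markedPerms, List.mem_flatMap, ih, descList]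
    constructor
    · rintro ⟨c, hc, hd⟩
      exact (perm_of_mem_insertions hd).trans (hc.cons _)
    · intro h
      have hmem : N + 1 ∈ d.map Prod.fst := h.mem_iff.2 (by simp)
      have hd := mem_insertions_deleteMark hmem
      exact ⟨_, (List.perm_cons _).1 ((perm_of_mem_insertions hd).symm.trans h), hd⟩

lemma succ_notMem_of_perm {N : ℕ} {l : List ℕ} (h : l.Perm (descList N)) : N + 1 ∉ l := by
  rw [h.mem_iff, mem_descList]
  omega

lemma nodup_markedPerms (N : ℕ) : (markedPerms N).Nodup := by
  induction N with
  | zero => simp [markedPerms]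
  | succ N ih =>
    rw [markedPerms, List.nodup_flatMap]
    refine ⟨fun c hc => nodup_insertions (succ_notMem_of_perm (mem_markedPerms.1 hc)),
      ih.pairwise_of_forall_ne fun c hc c' hc' hne d hd hd' => hne ?_⟩
    rw [← deleteMark_of_mem_insertions hd (succ_notMem_of_perm (mem_markedPerms.1 hc)),
      deleteMark_of_mem_insertions hd' (succ_notMem_of_perm (mem_markedPerms.1 hc'))]

/-! ### Insertion of a largest letter into a marked word -/

lemma numMarks_cons (b : ℕ) (f : Bool) (c : List (ℕ × Bool)) :
    numMarks ((b, f) :: c) = numMarks c + if f then 1 else 0 := by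
  simp [numMarks, List.countP_cons]

lemma embrace_insertions {N z : ℕ} (hz : z < N) {c d : List (ℕ × Bool)} (h : d ∈ insertions N c)
    (p : ℕ) : embrace z p d = embrace z p c := by
  suffices H : ∀ c d, d ∈ insertions N c → ∀ p, embrace z p d = embrace z p c from H c d h p
  refine insertions_cases (fun g p => ?_) (fun g f b c p => ?_) fun b f c d _ h p => ?_
  · simp [embrace, hz.le]
  · simp [embrace, hz.le]
  · simp [embrace, h]

/-- The largest letter is embraced by exactly the descents from a letter `∞`. -/
lemma embrace_eq_numMarks {N p : ℕ} (hp : p < N) {c : List (ℕ × Bool)}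
    (hc : ∀ y ∈ c.map Prod.fst, y < N) : embrace N p c = numMarks c := by
  induction c generalizing p with
  | nil => rfl
  | cons x c ih =>
    obtain ⟨b, f⟩ := x
    simp only [List.map_cons, List.mem_cons, forall_eq_or_imp] at hc
    rw [embrace, ih hc.1 hc.2, numMarks_cons, add_comm]
    simp [hc.1, hp.not_ge]

/-- The new letter `N` contributes its embracing number, and `N` if it is a descent bottom. The other
contributions do not change: a letter that loses its mark becomes a descent bottom after `N`. -/
lemma markedMak_insertions {N p : ℕ} (hp : p ≤ N) {c d : List (ℕ × Bool)}
    (h : d ∈ insertions N c) (hN : 0 < N) (hc : ∀ y ∈ c.map Prod.fst, y < N) :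
    markedMak p d = markedMak p c + ((if markOf N d then N else 0) +
      numMarks (after Prod.fst N d)) := by
  suffices H : ∀ c d, d ∈ insertions N c → ∀ p ≤ N, (∀ y ∈ c.map Prod.fst, y < N) →
      markedMak p d = markedMak p c + ((if markOf N d then N else 0) +
        numMarks (after Prod.fst N d)) from H c d h p hp hc
  refine insertions_cases (fun g p hp _ => ?_) (fun g f b c p hp hc => ?_)
    fun b f c d hd h p hp hc => ?_
  · simp [markedMak, markOf, after, hp.not_gt, embrace, numMarks]
  · simp only [List.map_cons, List.mem_cons, forall_eq_or_imp] at hc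
    have h0 : embrace N 0 ((b, f) :: c) = numMarks ((b, f) :: c) :=
      embrace_eq_numMarks hN (by simpa using hc)
    rw [markedMak, h0]
    simp [markedMak, markOf, after, hp.not_gt, hc.1]
    ring
  · simp only [List.map_cons, List.mem_cons, forall_eq_or_imp] at hc
    rw [markedMak, markedMak, h b hc.1.le hc.2, embrace_insertions hc.1 hd]
    simp [markOf, after, hc.1.ne]
    ring

lemma rlmin_insertions {N : ℕ} {c d : List (ℕ × Bool)} (h : d ∈ insertions N c)
    (hc : ∀ y ∈ c.map Prod.fst, y < N) :
    rlmin (d.map Prod.fst) =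
      rlmin (c.map Prod.fst) + if after Prod.fst N d = [] then 1 else 0 := by
  suffices H : ∀ c d, d ∈ insertions N c → (∀ y ∈ c.map Prod.fst, y < N) →
      rlmin (d.map Prod.fst) =
        rlmin (c.map Prod.fst) + if after Prod.fst N d = [] then 1 else 0 from H c d h hc
  refine insertions_cases (fun g _ => ?_) (fun g f b c hc => ?_) fun b f c d hd h hc => ?_
  · simp [rlmin, after]
  · simp only [List.map_cons, List.mem_cons, forall_eq_or_imp] at hc
    simp [rlmin, after, hc.1.le]
  · simp only [List.map_cons, List.mem_cons, forall_eq_or_imp] at hc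
    have hiff : (∀ y ∈ d.map Prod.fst, b < y) ↔ ∀ y ∈ c.map Prod.fst, b < y := by
      simp only [(perm_of_mem_insertions hd).mem_iff, List.mem_cons, forall_eq_or_imp, hc.1,
        true_and]
    simp only [List.map_cons, rlmin, hiff, h hc.2, after, hc.1.ne, if_false]
    ring

section InsertionSums

variable {R : Type*} [CommRing R]

/-- The sum of `F` over all insertions of a new letter into a marked word with `k` marks, `j` of
which lie in the range that is open for the insertion. The arguments of `F` are the number of marks
after the insertion, whether the new letter is marked, the number of marks on its right, and whether
it is the last letter. -/
def insertionSum (F : ℤ → Bool → ℕ → Bool → R) (k : ℤ) (j : ℕ) : R :=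
  ∑ e ∈ Finset.range (j + 1), (F (k + 1) true e (e = 0) + F k false e (e = 0)) +
    ∑ e ∈ Finset.range j, (F k true e false + F (k - 1) false e false)

lemma insertionSum_shift (F : ℤ → Bool → ℕ → Bool → R) (k : ℤ) (j : ℕ) :
    insertionSum F (k + 1) j = insertionSum (fun k => F (k + 1)) k j := by
  simp [insertionSum]

/-- If the new letter can go anywhere, then all the marks lie in its range. -/
lemma sum_insertions (N : ℕ) {c : List (ℕ × Bool)} (hN : N ∉ c.map Prod.fst)
    (F : ℤ → Bool → ℕ → Bool → R) :
    ((insertions N c).map fun d => F (numMarks d) (markOf N d) (numMarks (after Prod.fst N d))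
      (after Prod.fst N d = [])).sum = insertionSum F (numMarks c) (numMarks c) := by
  induction c generalizing F with
  | nil => simp [insertions, numMarks, markOf, after, insertionSum]
  | cons x c ih =>
    obtain ⟨b, f⟩ := x
    simp only [List.map_cons, List.mem_cons, not_or] at hN
    cases f
    · simp only [insertions, List.map_map, Function.comp_def, numMarks_cons, markOf, after,
        Ne.symm hN.1, if_false, add_zero, ih hN.2, Bool.false_eq_true]
    · simp only [insertions, List.map_append, List.sum_append, List.map_map, Function.comp_def,
        numMarks_cons, markOf, after, Ne.symm hN.1, if_false, if_true, Nat.cast_add, Nat.cast_one,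
        List.map_cons, List.sum_cons, List.map_nil, List.sum_nil]
      rw [ih hN.2 fun k => F (k + 1), insertionSum_shift]
      simp only [insertionSum, Finset.sum_range_succ _ (numMarks c + 1),
        Finset.sum_range_succ _ (numMarks c)]
      simp
      ring

/-- If the new letter has to go to the right of the letter `m`, then exactly the marks to the right
of `m` lie in its range. -/
lemma sum_insertions_after (N m : ℕ) {c : List (ℕ × Bool)} (hN : N ∉ c.map Prod.fst)
    (hm : m ∈ c.map Prod.fst) (F : ℤ → Bool → ℕ → Bool → R) :
    ((insertions N c).map fun d => if [m, N].Sublist (d.map Prod.fst) then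
      F (numMarks d) (markOf N d) (numMarks (after Prod.fst N d)) (after Prod.fst N d = [])
      else 0).sum = insertionSum F (numMarks c) (numMarks (after Prod.fst m c)) := by
  induction c generalizing F with
  | nil => simp at hm
  | cons x c ih =>
    obtain ⟨b, f⟩ := x
    have hmN : m ≠ N := by rintro rfl; exact hN hm
    simp only [List.map_cons, List.mem_cons, not_or] at hN hm
    -- The insertions in front of `b` do not contribute.
    have head : ¬ [m, N].Sublist (N :: b :: c.map Prod.fst) := by
      intro h
      rw [List.sublist_cons_iff] at h
      rcases h with h | ⟨r, hr, -⟩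
      · have := h.subset (a := N) (by simp)
        simp [hN] at this
      · simp [hmN] at hr
    have red : ((insertions N ((b, f) :: c)).map fun d => if [m, N].Sublist (d.map Prod.fst) then
        F (numMarks d) (markOf N d) (numMarks (after Prod.fst N d)) (after Prod.fst N d = [])
        else 0).sum = ((insertions N c).map fun d => if [m, N].Sublist (b :: d.map Prod.fst) then
        F (numMarks d + if f then 1 else 0) (markOf N d) (numMarks (after Prod.fst N d))
          (after Prod.fst N d = []) else 0).sum := by
      cases f
      · simp [insertions, Function.comp_def, numMarks_cons, markOf, after, Ne.symm hN.1]
      · simp [insertions, Function.comp_def, numMarks_cons, markOf, after, Ne.symm hN.1, head]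
    rw [red, after]
    have cast : ((numMarks ((b, f) :: c) : ℕ) : ℤ) = (numMarks c : ℤ) + if f then 1 else 0 := by
      rw [numMarks_cons]; cases f <;> simp
    have shift : ∀ j, insertionSum (fun k => F (k + if f then 1 else 0)) (numMarks c) j =
        insertionSum F (numMarks ((b, f) :: c)) j := by
      intro j
      rw [cast]
      cases f
      · simp
      · simpa using (insertionSum_shift F _ j).symm
    by_cases hb : b = m
    · subst hb
      rw [if_pos rfl, ← shift, ← sum_insertions N hN.2]
      refine congrArg List.sum (List.map_congr_left fun d hd => if_pos ?_)
      have : N ∈ d.map Prod.fst := (perm_of_mem_insertions hd).mem_iff.2 (by simp)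
      exact (List.singleton_sublist.2 this).cons_cons b
    · rw [if_neg hb, ← shift, ← ih hN.2 (by tauto)]
      refine congrArg List.sum (List.map_congr_left fun d hd => ?_)
      have : [m, N].Sublist (b :: d.map Prod.fst) ↔ [m, N].Sublist (d.map Prod.fst) := by
        rw [List.sublist_cons_iff]
        refine or_iff_left ?_
        rintro ⟨r, hr, -⟩
        exact hb (List.cons.inj hr).1.symm
      simp only [this]

end InsertionSums

/-! ### Insertion of a largest letter into a permutation -/

lemma permutations'Aux_cases {N : ℕ} {P : List ℕ → List ℕ → Prop}
    (head : ∀ l, P l (N :: l))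
    (tail : ∀ b l d, d ∈ List.permutations'Aux N l → P l d → P (b :: l) (b :: d)) :
    ∀ l d, d ∈ List.permutations'Aux N l → P l d := by
  intro l
  induction l with
  | nil =>
    intro d hd
    simp only [List.permutations'Aux, List.mem_cons, List.not_mem_nil, or_false] at hd
    exact hd ▸ head _
  | cons b l ih =>
    intro d hd
    simp only [List.permutations'Aux, List.mem_cons, List.mem_map] at hd
    rcases hd with rfl | ⟨d, hd, rfl⟩
    · exact head _
    · exact tail _ _ _ hd (ih d hd)

lemma perm_of_mem_permutations'Aux {N : ℕ} {l d : List ℕ} (h : d ∈ List.permutations'Aux N l) :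
    d.Perm (N :: l) := by
  suffices H : ∀ l d, d ∈ List.permutations'Aux N l → d.Perm (N :: l) from H l d h
  exact permutations'Aux_cases (fun l => .refl _) fun b l d _ h => (h.cons b).trans (.swap _ _ _)

lemma filter_of_mem_permutations'Aux {N : ℕ} {l d : List ℕ} (h : d ∈ List.permutations'Aux N l)
    (hN : N ∉ l) : d.filter (· ≠ N) = l := by
  suffices H : ∀ l d, d ∈ List.permutations'Aux N l → N ∉ l → d.filter (· ≠ N) = l from H l d h hN
  refine permutations'Aux_cases (fun l hN => ?_) fun b l d _ h hN => ?_
  · rw [List.filter_cons_of_neg (by simp), List.filter_eq_self.2]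
    intro x hx
    simpa using fun h : x = N => hN (h ▸ hx)
  · simp only [List.mem_cons, not_or] at hN
    rw [List.filter_cons_of_pos (by simpa using Ne.symm hN.1), h hN.2]

lemma listInv_permutations'Aux {N : ℕ} {l d : List ℕ} (h : d ∈ List.permutations'Aux N l)
    (hl : ∀ y ∈ l, y < N) : listInv d = listInv l + (after id N d).length := by
  suffices H : ∀ l d, d ∈ List.permutations'Aux N l → (∀ y ∈ l, y < N) →
      listInv d = listInv l + (after id N d).length from H l d h hl
  refine permutations'Aux_cases (fun l hl => ?_) fun b l d hd h hl => ?_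
  · rw [listInv, List.countP_eq_length.2 (by simpa using hl)]
    simp [after, add_comm]
  · simp only [List.mem_cons, forall_eq_or_imp] at hl
    simp only [listInv, h hl.2, after, id, hl.1.ne, if_false,
      (perm_of_mem_permutations'Aux hd).countP_eq]
    rw [List.countP_cons_of_neg (by simpa using hl.1.le), add_assoc]

lemma rlmin_permutations'Aux {N : ℕ} {l d : List ℕ} (h : d ∈ List.permutations'Aux N l)
    (hl : ∀ y ∈ l, y < N) : rlmin d = rlmin l + if (after id N d).length = 0 then 1 else 0 := by
  suffices H : ∀ l d, d ∈ List.permutations'Aux N l → (∀ y ∈ l, y < N) →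
      rlmin d = rlmin l + if (after id N d).length = 0 then 1 else 0 from H l d h hl
  refine permutations'Aux_cases (fun l hl => ?_) fun b l d hd h hl => ?_
  · rcases l with _ | ⟨b, l⟩
    · simp [rlmin, after]
    · have : b < N := hl b (by simp)
      simp [rlmin, after, this.le]
  · simp only [List.mem_cons, forall_eq_or_imp] at hl
    have hiff : (∀ y ∈ d, b < y) ↔ ∀ y ∈ l, b < y := by
      simp only [(perm_of_mem_permutations'Aux hd).mem_iff, List.mem_cons, forall_eq_or_imp, hl.1,
        true_and]
    simp only [rlmin, hiff, h hl.2, after, id, hl.1.ne, if_false]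
    ring

section PermutationSums

variable {R : Type*} [CommRing R]

lemma sum_permutations'Aux (N : ℕ) {l : List ℕ} (hN : N ∉ l) (F : ℕ → R) :
    ((List.permutations'Aux N l).map fun d => F (after id N d).length).sum =
      ∑ p ∈ Finset.range (l.length + 1), F p := by
  induction l with
  | nil => simp [after]
  | cons b l ih =>
    simp only [List.mem_cons, not_or] at hN
    rw [List.length_cons, Finset.sum_range_succ, ← ih hN.2]
    simp [after, Function.comp_def, Ne.symm hN.1, add_comm]

lemma sum_permutations'Aux_after (N m : ℕ) {l : List ℕ} (hN : N ∉ l) (hm : m ∈ l) (F : ℕ → R) :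
    ((List.permutations'Aux N l).map fun d =>
      if [m, N].Sublist d then F (after id N d).length else 0).sum =
      ∑ p ∈ Finset.range ((after id m l).length + 1), F p := by
  induction l with
  | nil => simp at hm
  | cons b l ih =>
    have hmN : m ≠ N := by rintro rfl; exact hN hm
    simp only [List.mem_cons, not_or] at hN hm
    have head : ¬ [m, N].Sublist (N :: b :: l) := by
      intro h
      rw [List.sublist_cons_iff] at h
      rcases h with h | ⟨r, hr, -⟩
      · have := h.subset (a := N) (by simp)
        simp [hN] at this
      · simp [hmN] at hr
    simp only [List.permutations'Aux, List.map_cons, List.sum_cons, head, if_false, zero_add,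
      List.map_map, Function.comp_def, after, id, Ne.symm hN.1]
    by_cases hb : b = m
    · subst hb
      rw [if_pos rfl, ← sum_permutations'Aux N hN.2]
      refine congrArg List.sum (List.map_congr_left fun d hd => if_pos ?_)
      have : N ∈ d := (perm_of_mem_permutations'Aux hd).mem_iff.2 (by simp)
      exact (List.singleton_sublist.2 this).cons_cons b
    · rw [if_neg hb, ← ih hN.2 (by tauto)]
      refine congrArg List.sum (List.map_congr_left fun d hd => ?_)
      have : [m, N].Sublist (b :: d) ↔ [m, N].Sublist d := by
        rw [List.sublist_cons_iff]
        refine or_iff_left ?_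
        rintro ⟨r, hr, -⟩
        exact hb (List.cons.inj hr).1.symm
      simp only [this]

/-! ### Comparison of marked permutations with permutations -/

open Classical in
/-- The sum over the marked permutations of `1, …, N` with `InvDesSubset S N`, where `q` keeps track
of `mak`, `t` of the right-to-left minima, and `Φ` of the number of marks and the number of marks to
the right of the letter `N`. -/
noncomputable def markedPermSum (q t : R) (S : Finset ℕ) (N : ℕ) (Φ : ℤ → ℕ → R) : R :=
  ((markedPerms N).map fun d => if InvDesSubset S N (d.map Prod.fst) then
    q ^ markedMak 0 d * t ^ rlmin (d.map Prod.fst) *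
      Φ (numMarks d) (numMarks (after Prod.fst N d)) else 0).sum

open Classical in
/-- The sum over the permutations of `1, …, N` with `InvDesSubset S N`, where `q` keeps track of
`inv`, `t` of the right-to-left minima, and `Ψ` of the number of letters to the right of `N`. -/
noncomputable def permSum (q t : R) (S : Finset ℕ) (N : ℕ) (Ψ : ℕ → R) : R :=
  ((List.permutations' (descList N)).map fun l => if InvDesSubset S N l then
    q ^ listInv l * t ^ rlmin l * Ψ (after id N l).length else 0).sum

lemma lt_succ_of_perm {N : ℕ} {l : List ℕ} (h : l.Perm (descList N)) : ∀ y ∈ l, y < N + 1 :=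
  fun y hy => by have := mem_descList.1 (h.mem_iff.1 hy); omega

lemma sum_map_flatMap {α β : Type*} (L : List α) (f : α → List β) (g : β → R) :
    ((L.flatMap f).map g).sum = (L.map fun a => ((f a).map g).sum).sum := by
  induction L with
  | nil => simp
  | cons a L ih => simp [ih]

lemma insertionSum_eq_insertMarked (q t : R) (N : ℕ) (Φ : ℤ → ℕ → R) (k : ℤ) (j : ℕ) :
    insertionSum (fun k g e b => q ^ ((if g then N else 0) + e) * t ^ (if b then 1 else 0) * Φ k e)
      k j = insertMarked q t Φ k j + q ^ N * insertMarked q t (fun k e => Φ (k + 1) e) k j := by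
  have h (e : ℕ) : t ^ (if e = 0 then 1 else 0) = if e = 0 then t else 1 := by split_ifs <;> simp
  simp only [insertionSum, insertMarked, stepWeight, mul_add, Finset.mul_sum,
    Finset.sum_add_distrib, decide_eq_true_eq, h, if_true, Bool.false_eq_true, if_false, pow_zero,
    mul_one, zero_add, sub_add_cancel, pow_add, mul_assoc]
  ring

open Classical in
/-- If `N ∉ S`, then `N + 1` has to be inserted to the right of `N`; otherwise all `k` marks are
available. -/
lemma markedPermSum_succ (q t : R) (S : Finset ℕ) (N : ℕ) (Φ : ℤ → ℕ → R) :
    markedPermSum q t S (N + 1) Φ = markedPermSum q t S N fun k j =>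
      insertMarked q t Φ k (if 1 ≤ N ∧ N ∉ S then j else k.toNat) +
        q ^ (N + 1) * insertMarked q t (fun k e => Φ (k + 1) e) k
          (if 1 ≤ N ∧ N ∉ S then j else k.toNat) := by
  rw [markedPermSum, markedPerms, sum_map_flatMap, markedPermSum]
  refine congrArg List.sum (List.map_congr_left fun c hc => ?_)
  rw [mem_markedPerms] at hc
  have hN := succ_notMem_of_perm hc
  have hlt := lt_succ_of_perm hc
  set W := q ^ markedMak 0 c * t ^ rlmin (c.map Prod.fst) with hW
  let F : ℤ → Bool → ℕ → Bool → R := fun k g e b =>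
    q ^ ((if g then N + 1 else 0) + e) * t ^ (if b then 1 else 0) * Φ k e
  have hterm : ∀ d ∈ insertions (N + 1) c, q ^ markedMak 0 d * t ^ rlmin (d.map Prod.fst) *
      Φ (numMarks d) (numMarks (after Prod.fst (N + 1) d)) =
      W * F (numMarks d) (markOf (N + 1) d) (numMarks (after Prod.fst (N + 1) d))
        (after Prod.fst (N + 1) d = []) := by
    intro d hd
    rw [markedMak_insertions (Nat.zero_le _) hd N.succ_pos hlt, rlmin_insertions hd hlt, hW]
    simp only [F, pow_add, decide_eq_true_eq]
    ring
  by_cases hS : InvDesSubset S N (c.map Prod.fst)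
  swap
  · rw [if_neg hS]
    refine List.sum_eq_zero fun x hx => ?_
    obtain ⟨d, hd, rfl⟩ := List.mem_map.1 hx
    exact if_neg fun h => hS ((invDesSubset_succ (filter_of_mem_insertions hd hN)).1 h).1
  rw [if_pos hS]
  by_cases hr : 1 ≤ N ∧ N ∉ S
  · simp only [if_pos hr]
    rw [← insertionSum_eq_insertMarked, ← sum_insertions_after (N + 1) N hN
      (hc.mem_iff.2 (mem_descList.2 ⟨hr.1, le_rfl⟩)), ← List.sum_map_mul_left]
    refine congrArg List.sum (List.map_congr_left fun d hd => ?_)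
    rw [hterm d hd, mul_ite, mul_zero]
    have hiff := invDesSubset_succ (S := S) (filter_of_mem_insertions hd hN)
    exact if_congr ⟨fun h => (hiff.1 h).2 hr, fun h => hiff.2 ⟨hS, fun _ => h⟩⟩ rfl rfl
  · simp only [if_neg hr, Int.toNat_natCast]
    rw [← insertionSum_eq_insertMarked, ← sum_insertions (N + 1) hN, ← List.sum_map_mul_left]
    refine congrArg List.sum (List.map_congr_left fun d hd => ?_)
    rw [if_pos ((invDesSubset_succ (filter_of_mem_insertions hd hN)).2 ⟨hS, fun h => (hr h).elim⟩),
      hterm d hd]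

open Classical in
lemma permSum_succ (q t : R) (S : Finset ℕ) (N : ℕ) (Ψ : ℕ → R) :
    permSum q t S (N + 1) Ψ = permSum q t S N fun P =>
      ∑ p ∈ Finset.range ((if 1 ≤ N ∧ N ∉ S then P else N) + 1), stepWeight q t p * Ψ p := by
  rw [permSum, descList, List.permutations', sum_map_flatMap, permSum]
  refine congrArg List.sum (List.map_congr_left fun c hc => ?_)
  rw [List.mem_permutations'] at hc
  have hN := succ_notMem_of_perm hc
  have hlt := lt_succ_of_perm hc
  set W := q ^ listInv c * t ^ rlmin c with hW
  have hterm : ∀ d ∈ List.permutations'Aux (N + 1) c, q ^ listInv d * t ^ rlmin d *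
      Ψ (after id (N + 1) d).length = W * (stepWeight q t (after id (N + 1) d).length *
        Ψ (after id (N + 1) d).length) := by
    intro d hd
    rw [listInv_permutations'Aux hd hlt, rlmin_permutations'Aux hd hlt, hW, stepWeight]
    split_ifs <;> ring
  by_cases hS : InvDesSubset S N c
  swap
  · rw [if_neg hS]
    refine List.sum_eq_zero fun x hx => ?_
    obtain ⟨d, hd, rfl⟩ := List.mem_map.1 hx
    exact if_neg fun h => hS ((invDesSubset_succ (filter_of_mem_permutations'Aux hd hN)).1 h).1
  rw [if_pos hS]
  by_cases hr : 1 ≤ N ∧ N ∉ S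
  · simp only [if_pos hr]
    rw [← sum_permutations'Aux_after (N + 1) N hN
      (hc.mem_iff.2 (mem_descList.2 ⟨hr.1, le_rfl⟩)), ← List.sum_map_mul_left]
    refine congrArg List.sum (List.map_congr_left fun d hd => ?_)
    rw [hterm d hd, mul_ite, mul_zero]
    have hiff := invDesSubset_succ (S := S) (filter_of_mem_permutations'Aux hd hN)
    exact if_congr ⟨fun h => (hiff.1 h).2 hr, fun h => hiff.2 ⟨hS, fun _ => h⟩⟩ rfl rfl
  · simp only [if_neg hr]
    have hlen : c.length = N := hc.length_eq.trans (length_descList N)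
    conv_rhs => rw [← hlen]
    rw [← sum_permutations'Aux (c.length + 1) (by rwa [hlen]), ← List.sum_map_mul_left, hlen]
    refine congrArg List.sum (List.map_congr_left fun d hd => ?_)
    rw [if_pos ((invDesSubset_succ (filter_of_mem_permutations'Aux hd hN)).2
        ⟨hS, fun h => (hr h).elim⟩),
      hterm d hd]

lemma length_after_le {α : Type*} (key : α → ℕ) (m : ℕ) (l : List α) :
    (after key m l).length ≤ l.length := by
  induction l with
  | nil => simp [after]
  | cons b l ih =>
    rw [after]
    split_ifs <;> simp
    omega

/-- The marks are distributed like a set `A ⊆ {1, …, N}` that is independent of the permutation,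
except that the marks to the right of `N` correspond to the elements of `A` that are at most the
number of letters to the right of `N`. -/
theorem markedPermSum_eq (q t : R) (S : Finset ℕ) (N : ℕ) (Φ : ℤ → ℕ → R) :
    markedPermSum q t S N Φ = permSum q t S N fun p => markedSum q p N Φ := by
  induction N generalizing Φ with
  | zero =>
    simp [markedPermSum, permSum, markedPerms, descList, markedMak, listInv, rlmin, numMarks, after,
      markedSum, InvDesSubset]
  | succ N ih =>
    rw [markedPermSum_succ, ih, permSum_succ, permSum, permSum]
    refine congrArg List.sum (List.map_congr_left fun c hc => ?_)
    rw [List.mem_permutations'] at hc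
    have hlen : c.length = N := hc.length_eq.trans (length_descList N)
    have hle := length_after_le id N c
    set P := (after id N c).length
    set Q := if 1 ≤ N ∧ N ∉ S then P else N with hQ
    have hQN : Q ≤ N := by rw [hQ]; split_ifs <;> omega
    congr 2
    rw [← markedSum_insertMarked q t (by omega : Q ≤ N + 1), markedSum_succ_of_le q hQN,
      ← markedSum_mul, ← markedSum_add]
    simp only [insertMarked_shift]
    by_cases hr : 1 ≤ N ∧ N ∉ S
    · simp only [hQ, if_pos hr]
    · simp only [hQ, if_neg hr]
      rw [markedSum_const q P N N]
      exact markedSum_self_congr q N _ _ fun k => by rw [Int.toNat_natCast]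

end PermutationSums

/-! ### Words without marks -/

section Unmarked

variable {R : Type*} [CommRing R]

lemma markedSum_eq_zero (q : R) (p N : ℕ) {Φ : ℤ → ℕ → R} (h : ∀ k j, 0 ≤ k → Φ k j = 0) :
    markedSum q p N Φ = 0 := by
  induction N generalizing Φ with
  | zero => exact h 0 0 le_rfl
  | succ N ih => rw [markedSum, ih h, ih fun k j hk => h _ _ (by omega), mul_zero, add_zero]

lemma markedSum_eq_apply_zero (q : R) (p N : ℕ) {Φ : ℤ → ℕ → R} (h : ∀ k j, 0 < k → Φ k j = 0) :
    markedSum q p N Φ = Φ 0 0 := by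
  induction N generalizing Φ with
  | zero => rfl
  | succ N ih =>
    rw [markedSum, ih h, markedSum_eq_zero q p N fun k j hk => h _ _ (by omega), mul_zero, add_zero]

/-- A word, considered as a marked word without marks. -/
def unmarked (l : List ℕ) : List (ℕ × Bool) := l.map fun x => (x, false)

lemma map_fst_unmarked (l : List ℕ) : (unmarked l).map Prod.fst = l := by
  simp [unmarked, Function.comp_def]

lemma numMarks_eq_zero_iff {c : List (ℕ × Bool)} :
    numMarks c = 0 ↔ c = unmarked (c.map Prod.fst) := by
  induction c with
  | nil => simp [numMarks, unmarked]
  | cons x c ih =>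
    obtain ⟨b, f⟩ := x
    rw [numMarks_cons]
    simp only [unmarked, List.map_cons, List.cons.injEq, Prod.mk.injEq, true_and] at ih ⊢
    cases f <;> simp [ih]

lemma nodup_permutations_descList (N : ℕ) : (List.permutations' (descList N)).Nodup :=
  (List.permutations_perm_permutations' _).nodup_iff.1
    (List.nodup_permutations _ (nodup_descList N))

lemma filter_markedPerms_perm (N : ℕ) :
    ((markedPerms N).filter fun d => numMarks d = 0).Perm
      ((List.permutations' (descList N)).map unmarked) := by
  have hinj : Function.Injective unmarked :=
    Function.LeftInverse.injective (g := List.map Prod.fst) map_fst_unmarked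
  refine (List.perm_ext_iff_of_nodup ((nodup_markedPerms N).filter _)
    ((nodup_permutations_descList N).map hinj)).2 fun d => ?_
  simp only [List.mem_filter, mem_markedPerms, decide_eq_true_eq, List.mem_map,
    List.mem_permutations']
  constructor
  · rintro ⟨h1, h2⟩
    exact ⟨_, h1, (numMarks_eq_zero_iff.1 h2).symm⟩
  · rintro ⟨l, hl, rfl⟩
    rw [numMarks_eq_zero_iff, map_fst_unmarked]
    exact ⟨hl, rfl⟩

open Classical in
/-- The statistics `(mak, rlmin)` and `(inv, rlmin)` have the same generating function on the
permutations of `1, …, N` with `InvDesSubset S N`. -/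
theorem sum_markedMak_eq_sum_listInv (q t : R) (S : Finset ℕ) (N : ℕ) :
    ((List.permutations' (descList N)).map fun l => if InvDesSubset S N l then
      q ^ markedMak 0 (unmarked l) * t ^ rlmin l else 0).sum =
    ((List.permutations' (descList N)).map fun l => if InvDesSubset S N l then
      q ^ listInv l * t ^ rlmin l else 0).sum := by
  have h := markedPermSum_eq q t S N fun k _ => if k = 0 then 1 else 0
  -- This `Φ` selects the permutations without marks, and on the other side the empty set.
  have hΦ : ∀ p, markedSum q p N (fun k _ => if k = 0 then 1 else 0) = 1 := fun p => by
    rw [markedSum_eq_apply_zero q p N fun k j hk => if_neg hk.ne', if_pos rfl]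
  simp only [permSum, hΦ, mul_one] at h
  rw [← h, markedPermSum]
  have key := ((filter_markedPerms_perm N).map fun d =>
    if InvDesSubset S N (d.map Prod.fst) then
      q ^ markedMak 0 d * t ^ rlmin (d.map Prod.fst) else 0).sum_eq
  simp only [List.map_map, Function.comp_def, map_fst_unmarked] at key
  rw [← key]
  generalize markedPerms N = L
  induction L with
  | nil => rfl
  | cons d L ih =>
    by_cases hd : numMarks d = 0
    · rw [List.filter_cons_of_pos (by simpa using hd), List.map_cons, List.map_cons, List.sum_cons,
        List.sum_cons, ih]
      simp [hd]
    · rw [List.filter_cons_of_neg (by simpa using hd), List.map_cons, List.sum_cons, ih]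
      simp [hd]

end Unmarked

/-! ### The list of values of a permutation -/

/-- The one-line notation of a permutation as a list. -/
def permList {n : ℕ} (π : Equiv.Perm (Fin n)) : List ℕ := List.ofFn (oneLine π)

lemma oneLine_injective {n : ℕ} (π : Equiv.Perm (Fin n)) : Function.Injective (oneLine π) :=
  fun _ _ h => π.injective (Fin.ext (Nat.succ_injective h))

lemma nodup_permList {n : ℕ} (π : Equiv.Perm (Fin n)) : (permList π).Nodup :=
  List.nodup_ofFn.2 (oneLine_injective π)

lemma permList_perm {n : ℕ} (π : Equiv.Perm (Fin n)) : (permList π).Perm (descList n) := by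
  refine (List.perm_ext_iff_of_nodup (nodup_permList π) (nodup_descList n)).2 fun x => ?_
  rw [permList, List.mem_ofFn, mem_descList]
  constructor
  · rintro ⟨i, rfl⟩
    simp [oneLine]
  · rintro ⟨h1, h2⟩
    refine ⟨π.symm ⟨x - 1, by omega⟩, ?_⟩
    simp [oneLine]
    omega

lemma permList_injective (n : ℕ) :
    Function.Injective (permList : Equiv.Perm (Fin n) → List ℕ) := by
  intro π ρ h
  ext i
  have := congrFun (List.ofFn_injective h) i
  simpa [oneLine] using this

lemma map_permList_perm (n : ℕ) :
    ((Finset.univ : Finset (Equiv.Perm (Fin n))).toList.map permList).Perm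
      (List.permutations' (descList n)) := by
  have hsub := List.subperm_of_subset
    (((Finset.univ : Finset (Equiv.Perm (Fin n))).nodup_toList).map (permList_injective n))
    (l₂ := List.permutations' (descList n)) (by
      intro l hl
      obtain ⟨π, -, rfl⟩ := List.mem_map.1 hl
      exact List.mem_permutations'.2 (permList_perm π))
  refine hsub.perm_of_length_le ?_
  rw [(List.permutations_perm_permutations' _).symm.length_eq, List.length_permutations,
    length_descList, List.length_map, Finset.length_toList, Finset.card_univ, Fintype.card_perm,
    Fintype.card_fin]

lemma sum_permList {M : Type*} [AddCommMonoid M] (n : ℕ) (F : List ℕ → M) :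
    ∑ π : Equiv.Perm (Fin n), F (permList π) =
      ((List.permutations' (descList n)).map F).sum := by
  rw [← ((map_permList_perm n).map F).sum_eq, List.map_map, ← Finset.sum_map_toList]
  rfl

lemma countP_ofFn {α : Type*} {n : ℕ} (f : Fin n → α) (p : α → Bool) :
    (List.ofFn f).countP p = ∑ i, if p (f i) then 1 else 0 := by
  induction n with
  | zero => simp
  | succ n ih => rw [List.ofFn_succ, List.countP_cons, ih, Fin.sum_univ_succ, add_comm]

lemma inv_eq_listInv {n : ℕ} (w : Fin n → ℕ) : inv w = listInv (List.ofFn w) := by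
  have h : inv w = ∑ i, ∑ j, if i < j ∧ w j < w i then 1 else 0 := by
    rw [inv, Finset.card_filter, Fintype.sum_prod_type]
  rw [h]
  clear h
  induction n with
  | zero => simp [listInv]
  | succ n ih =>
    rw [List.ofFn_succ, listInv, ← ih, countP_ofFn, Fin.sum_univ_succ]
    simp only [Fin.sum_univ_succ, Fin.succ_lt_succ_iff, Fin.not_lt_zero, false_and, if_false,
      Fin.succ_pos, true_and, decide_eq_true_eq, zero_add]

lemma rlmin_ofFn {n : ℕ} (w : Fin n → ℕ) :
    rlmin (List.ofFn w) = (Finset.univ.filter fun i => ∀ j, i < j → w i < w j).card := by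
  rw [Finset.card_filter]
  induction n with
  | zero => simp [rlmin]
  | succ n ih =>
    rw [List.ofFn_succ, rlmin, ih, Fin.sum_univ_succ]
    simp [Fin.forall_fin_succ, List.mem_ofFn]

lemma lrmax_eq_rlmin {n : ℕ} (π : Equiv.Perm (Fin n)) :
    lrmax (oneLine π) = rlmin (permList π⁻¹) := by
  rw [permList, rlmin_ofFn, lrmax, PLrmax]
  refine Finset.card_equiv π fun i => ?_
  simp only [Finset.mem_filter, Finset.mem_univ, true_and, oneLine, Equiv.Perm.coe_inv,
    Equiv.symm_apply_apply, add_lt_add_iff_right, Fin.val_fin_lt]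
  constructor
  · intro h j hj
    by_contra! hle
    rcases hle.lt_or_eq with hlt | heq
    · have := h _ hlt
      rw [Equiv.apply_symm_apply] at this
      exact lt_asymm hj this
    · exact hj.ne (by rw [← heq, Equiv.apply_symm_apply])
  · intro h j hj
    by_contra! hle
    rcases hle.lt_or_eq with hlt | heq
    · have := h _ hlt
      rw [Equiv.symm_apply_apply] at this
      exact lt_asymm hj this
    · exact hj.ne (π.injective heq.symm)

lemma inv_oneLine_inv {n : ℕ} (π : Equiv.Perm (Fin n)) :
    inv (oneLine π⁻¹) = inv (oneLine π) := by
  refine Finset.card_nbij' (fun p => (π⁻¹ p.2, π⁻¹ p.1)) (fun p => (π p.2, π p.1)) ?_ ?_ ?_ ?_ <;>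
    simp +contextual [oneLine, Set.MapsTo, Set.LeftInvOn]

lemma pair_sublist_ofFn {α : Type*} {n : ℕ} (w : Fin n → α) (a b : α) :
    [a, b].Sublist (List.ofFn w) ↔ ∃ i j, i < j ∧ w i = a ∧ w j = b := by
  induction n with
  | zero => simp
  | succ n ih =>
    rw [List.ofFn_succ, List.sublist_cons_iff, ih]
    simp [Fin.exists_fin_succ, List.mem_ofFn, eq_comm, or_comm]

lemma des_oneLine_subset_iff {n : ℕ} (S : Finset ℕ) (π : Equiv.Perm (Fin n)) :
    Des (oneLine π) ⊆ S ↔ InvDesSubset S n (permList π⁻¹) := by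
  have hval : ∀ (p i : Fin n), oneLine π⁻¹ p = (i : ℕ) + 1 ↔ p = π i := by
    intro p i
    simp [oneLine, Fin.val_inj, Equiv.symm_apply_eq]
  simp only [InvDesSubset, permList, pair_sublist_ofFn]
  constructor
  · intro h v h1 h2 hv
    let i : Fin n := ⟨v - 1, by omega⟩
    let j : Fin n := ⟨v, h2⟩
    have hi : (i : ℕ) + 1 = v := by simp only [i]; omega
    refine ⟨π i, π j, ?_, by rw [(hval _ _).2 rfl, hi], (hval _ _).2 rfl⟩
    by_contra! hle
    refine hv (h ?_)
    simp only [Des, Finset.mem_image, Finset.mem_filter, Finset.mem_univ, true_and]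
    refine ⟨i, ⟨j, hi.symm, ?_⟩, hi⟩
    have : π j ≠ π i := fun h => by
      have := congrArg Fin.val (π.injective h)
      simp only [i, j] at this
      omega
    simpa [oneLine] using hle.lt_of_ne this
  · intro h v hv
    simp only [Des, Finset.mem_image, Finset.mem_filter, Finset.mem_univ, true_and] at hv
    obtain ⟨i, ⟨j, hj, hlt⟩, rfl⟩ := hv
    by_contra hS
    obtain ⟨p, p', hpp, hp, hp'⟩ := h _ (by omega) (by omega) hS
    rw [hval] at hp
    rw [← hj, hval] at hp'
    subst hp hp'
    simp [oneLine] at hlt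
    exact lt_asymm hpp hlt

/-! ### The statistic `mak` as a sum over adjacent descents -/

section Blocks

variable {n : ℕ} {w : Fin n → ℕ}

lemma IsDescentBlock.lt {a b i j : Fin n} (h : IsDescentBlock w a b) (hai : a ≤ i) (hij : i < j)
    (hjb : j ≤ b) : w j < w i := by
  obtain ⟨j, hj⟩ := j
  induction j with
  | zero => exact absurd hij (by simp [Fin.lt_def])
  | succ j ih =>
    have hstep (k : Fin n) (hk : (k : ℕ) = j) (h1 : a ≤ k) : w ⟨j + 1, hj⟩ < w k := by
      obtain ⟨l, hl, hlt⟩ := h.2.1 k h1 (by simp only [Fin.lt_def, Fin.le_def] at *; omega)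
      have : l = ⟨j + 1, hj⟩ := Fin.ext (by simp [hl, hk])
      rwa [← this]
    rcases eq_or_ne (i : ℕ) j with hi | hi
    · exact hstep i hi hai
    · have hij' : i < ⟨j, by omega⟩ := by simp only [Fin.lt_def] at *; omega
      exact (hstep ⟨j, by omega⟩ rfl (hai.trans hij'.le)).trans
        (ih (by omega) hij' (by simp only [Fin.le_def] at *; omega))

lemma exists_descentBlock {k j : Fin n} (hj : (j : ℕ) = k + 1) (h : w j < w k) :
    ∃ B : Fin n × Fin n, IsDescentBlock w B.1 B.2 ∧ B.1 ≤ k ∧ j ≤ B.2 := by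
  obtain ⟨a, ⟨hak, ha⟩, hmin⟩ := wellFounded_lt.has_min
    {a : Fin n | a ≤ k ∧ ∀ m, a ≤ m → m ≤ k → IsDescent w m}
    ⟨k, le_rfl, fun m h1 h2 => by rw [le_antisymm h2 h1]; exact ⟨j, hj, h⟩⟩
  obtain ⟨b, ⟨hkb, hb⟩, hbmin⟩ := wellFounded_lt.has_min
    {b : Fin n | k < b ∧ ¬ IsDescent w b}
    ⟨⟨n - 1, by omega⟩, by simp only [Fin.lt_def]; omega, by
      rintro ⟨l, hl, -⟩
      simp only at hl
      omega⟩
  refine ⟨(a, b), ⟨hak.trans hkb.le, fun m h1 h2 => ?_, fun m hm hd => ?_, hb⟩, hak, ?_⟩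
  · rcases le_or_gt m k with hmk | hmk
    · exact ha m h1 hmk
    · by_contra hm
      exact hbmin m ⟨hmk, hm⟩ h2
  · have hm : (m : ℕ) + 1 = a := hm
    refine hmin m ⟨?_, fun l h1 h2 => ?_⟩ ?_
    · simp only [Fin.le_def] at *; omega
    · rcases eq_or_ne l m with rfl | hne
      · exact hd
      · refine ha l ?_ h2
        have : (l : ℕ) ≠ m := fun h => hne (Fin.ext h)
        simp only [Fin.le_def] at *
        omega
    · simp only [Fin.lt_def]; omega
  · simp only [Fin.le_def, Fin.lt_def] at *; omega

lemma IsDescentBlock.eq_of_mem {a b a' b' j : Fin n} (h : IsDescentBlock w a b)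
    (h' : IsDescentBlock w a' b') (haj : a < j) (hjb : j ≤ b) (haj' : a' < j) (hjb' : j ≤ b') :
    a = a' ∧ b = b' := by
  have left {a b a' b' : Fin n} (h : IsDescentBlock w a b) (h' : IsDescentBlock w a' b')
      (hjb : j ≤ b) (haj' : a' < j) : ¬ a < a' := by
    intro hlt
    simp only [Fin.lt_def, Fin.le_def] at *
    refine h'.2.2.1 ⟨a' - 1, by omega⟩ (by simp; omega) (h.2.1 _ ?_ ?_) <;>
      simp only [Fin.lt_def, Fin.le_def] <;> omega
  have right {a b a' b' : Fin n} (h : IsDescentBlock w a b) (h' : IsDescentBlock w a' b')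
      (hjb : j ≤ b) (haj' : a' < j) : ¬ b < b' := fun hlt =>
    h.2.2.2 (h'.2.1 b (haj'.le.trans hjb) hlt)
  exact ⟨le_antisymm (not_lt.1 (left h' h hjb' haj)) (not_lt.1 (left h h' hjb haj')),
    le_antisymm (not_lt.1 (right h' h hjb' haj)) (not_lt.1 (right h h' hjb haj'))⟩

/-- The index `j` is the bottom of a descent `w k, w j` of adjacent letters to the right of `w i`
with `w k ≥ w i > w j`. -/
def Embraces (w : Fin n → ℕ) (i j : Fin n) : Prop :=
  ∃ k : Fin n, (j : ℕ) = k + 1 ∧ i < k ∧ w i ≤ w k ∧ w j < w i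

lemma IsDescentBlock.exists_embraces {a b i : Fin n} (h : IsDescentBlock w a b) (hia : i < a)
    (h1 : w i ≤ w a) (h2 : w b < w i) : ∃ j, Embraces w i j ∧ a < j ∧ j ≤ b := by
  obtain ⟨j, ⟨haj, hj⟩, hmin⟩ := wellFounded_lt.has_min
    {j : Fin n | a ≤ j ∧ w j < w i} ⟨b, h.1, h2⟩
  have hlt : a < j := lt_of_le_of_ne haj fun h => (h ▸ hj).not_ge h1
  refine ⟨j, ⟨⟨j - 1, by omega⟩, ?_, ?_, ?_, hj⟩, hlt, ?_⟩
  · simp only [Fin.lt_def] at hlt ⊢; omega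
  · simp only [Fin.lt_def] at *; omega
  · by_contra! hlt'
    refine hmin _ ⟨?_, hlt'⟩ ?_ <;> simp only [Fin.lt_def, Fin.le_def] at * <;> omega
  · exact not_lt.1 (hmin b ⟨h.1, h2⟩)

lemma IsDescentBlock.embraces_unique {a b i j j' : Fin n} (h : IsDescentBlock w a b)
    (hj : Embraces w i j) (hj' : Embraces w i j') (haj : a < j) (haj' : a < j') (hjb : j ≤ b)
    (hjb' : j' ≤ b) : j = j' := by
  have key {j j' : Fin n} (hj : Embraces w i j) (hj' : Embraces w i j') (haj : a < j)
      (hjb' : j' ≤ b) : ¬ j < j' := by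
    intro hlt
    obtain ⟨k, hk, -, -, h1⟩ := hj
    obtain ⟨k', hk', -, h2, -⟩ := hj'
    rcases eq_or_ne j k' with rfl | hne
    · omega
    · have hne' : (j : ℕ) ≠ k' := fun h => hne (Fin.ext h)
      have := h.lt (i := j) (j := k') haj.le (by simp only [Fin.lt_def] at *; omega)
        (by simp only [Fin.le_def] at *; omega)
      omega
  exact le_antisymm (not_lt.1 (key hj' hj haj' hjb)) (not_lt.1 (key hj hj' haj hjb'))

open Classical in
/-- A descent block embraces a letter `w i` if and only if it contains a descent of adjacent letters
that embraces it, and this descent is unique. -/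
lemma embracing_eq (w : Fin n → ℕ) (i : Fin n) :
    embracing w i = (Finset.univ.filter fun j => Embraces w i j).card := by
  have hex : ∀ j, Embraces w i j → ∃ B : Fin n × Fin n,
      IsDescentBlock w B.1 B.2 ∧ B.1 < j ∧ j ≤ B.2 := by
    rintro j ⟨k, hk, -, h1, h2⟩
    obtain ⟨B, hB, h3, h4⟩ := exists_descentBlock hk (h2.trans_le h1)
    exact ⟨B, hB, by simp only [Fin.lt_def, Fin.le_def] at *; omega, h4⟩
  choose! f hf using hex
  symm
  refine Finset.card_bij (fun j _ => f j) (fun j hj => ?_) (fun j hj j' hj' he => ?_)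
    fun B hB => ?_
  · simp only [Finset.mem_filter, Finset.mem_univ, true_and] at hj ⊢
    obtain ⟨hB, h1, h2⟩ := hf j hj
    obtain ⟨k, hk, hik, h3, h4⟩ := hj
    have hak : (f j).1 ≤ k := by simp only [Fin.lt_def, Fin.le_def] at *; omega
    have hkb : k ≤ (f j).2 := by simp only [Fin.lt_def, Fin.le_def] at *; omega
    refine ⟨hB, h1.trans_le h2, ?_, ?_, ?_⟩
    · by_contra! hle
      exact (hB.lt hle hik hkb).not_ge h3
    · rcases hak.eq_or_lt with h | h
      · rwa [h]
      · exact h3.trans (hB.lt le_rfl h hkb).le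
    · rcases h2.eq_or_lt with h | h
      · rwa [← h]
      · exact (hB.lt h1.le h le_rfl).trans h4
  · simp only [Finset.mem_filter, Finset.mem_univ, true_and] at hj hj'
    obtain ⟨hB, h1, h2⟩ := hf j hj
    obtain ⟨-, h1', h2'⟩ := hf j' hj'
    rw [← he] at h1' h2'
    exact hB.embraces_unique hj hj' h1 h1' h2 h2'
  · simp only [Finset.mem_filter, Finset.mem_univ, true_and] at hB
    obtain ⟨hB, -, h1, h2, h3⟩ := hB
    obtain ⟨j, hj, h4, h5⟩ := hB.exists_embraces h1 h2 h3
    refine ⟨j, by simpa using hj, ?_⟩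
    obtain ⟨hB', h4', h5'⟩ := hf j hj
    have := hB'.eq_of_mem hB h4' h5' h4 h5
    exact Prod.ext this.1 this.2

end Blocks

lemma unmarked_cons (x : ℕ) (l : List ℕ) : unmarked (x :: l) = (x, false) :: unmarked l := rfl

lemma embrace_ofFn {n : ℕ} (w : Fin n → ℕ) (z p : ℕ) :
    embrace z p (unmarked (List.ofFn w)) =
      ∑ j : Fin n, if z ≤ (Fin.cons p w : Fin (n + 1) → ℕ) j.castSucc ∧ w j < z then 1 else 0 := by
  induction n generalizing p with
  | zero => simp [embrace, unmarked]
  | succ n ih =>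
    rw [List.ofFn_succ, unmarked_cons, embrace, ih, Fin.sum_univ_succ]
    have h : (Fin.cons (w 0) fun i => w i.succ : Fin (n + 1) → ℕ) = w := Fin.cons_self_tail w
    simp [h, Fin.castSucc_succ]

/-- The letter before the `j`-th letter, in a word preceded by the letter `0`. -/
lemma cons_zero_castSucc {n : ℕ} (w : Fin n → ℕ) (P : ℕ → Prop) (h0 : ¬ P 0) (j : Fin n) :
    P ((Fin.cons 0 w : Fin (n + 1) → ℕ) j.castSucc) ↔ ∃ k : Fin n, (j : ℕ) = k + 1 ∧ P (w k) := by
  cases n with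
  | zero => exact j.elim0
  | succ n =>
    cases j using Fin.cases with
    | zero => simp [h0]
    | succ j =>
      rw [← Fin.succ_castSucc, Fin.cons_succ]
      constructor
      · exact fun h => ⟨j.castSucc, by simp, h⟩
      · rintro ⟨k, hk, h⟩
        have : k = j.castSucc := Fin.ext (by simp at hk ⊢; omega)
        rwa [← this]

open Classical in
lemma markedMak_ofFn {n : ℕ} (w : Fin n → ℕ) (hw : ∀ i, 0 < w i) (p : ℕ) :
    markedMak p (unmarked (List.ofFn w)) =
      (∑ j : Fin n, if w j < (Fin.cons p w : Fin (n + 1) → ℕ) j.castSucc then w j else 0) +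
        ∑ i : Fin n, ∑ j : Fin n, if Embraces w i j then 1 else 0 := by
  induction n generalizing p with
  | zero => simp [markedMak, unmarked]
  | succ n ih =>
    have h : (Fin.cons (w 0) fun i => w i.succ : Fin (n + 1) → ℕ) = w := Fin.cons_self_tail w
    have h0 : ∀ i, ¬ Embraces w i 0 := fun i ⟨k, hk, _⟩ => by simp at hk
    have h1 : ∀ i j : Fin n, Embraces w i.succ j.succ ↔ Embraces (fun i => w i.succ) i j := by
      intro i j
      simp [Embraces, Fin.exists_fin_succ]
    have h2 : ∀ j : Fin n, Embraces w 0 j.succ ↔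
        w 0 ≤ (Fin.cons 0 fun i => w i.succ : Fin (n + 1) → ℕ) j.castSucc ∧ w j.succ < w 0 := by
      intro j
      rw [cons_zero_castSucc _ (fun x => w 0 ≤ x) (hw 0).not_ge]
      simp [Embraces, Fin.exists_fin_succ, ← exists_and_right, and_assoc]
    rw [List.ofFn_succ, unmarked_cons, markedMak, ih _ fun i => hw _, embrace_ofFn]
    simp only [Fin.sum_univ_succ, h0, h1, h2, h, if_false, zero_add, Fin.castSucc_zero,
      Fin.cons_zero, ← Fin.succ_castSucc, Fin.cons_succ, Bool.false_eq_true, false_or]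
    ring

lemma value_oneLine {n : ℕ} (π : Equiv.Perm (Fin n)) (i : Fin n) :
    value (oneLine π) i = oneLine π i := by
  have h1 : (Finset.univ.filter fun j : Fin n => j < i ∧ oneLine π j = oneLine π i) = ∅ := by
    rw [Finset.filter_eq_empty_iff]
    rintro j - ⟨h, h'⟩
    exact h.ne (oneLine_injective π h')
  have h2 : (Finset.univ.filter fun j : Fin n => oneLine π j < oneLine π i).card = π i := by
    rw [← Fin.card_Iio (π i)]
    exact Finset.card_equiv π fun j => by simp [oneLine]
  rw [value, height, h1, h2, oneLine, Finset.card_empty, add_zero, add_comm]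

lemma mak_oneLine {n : ℕ} (π : Equiv.Perm (Fin n)) :
    mak (oneLine π) = markedMak 0 (unmarked (permList π)) := by
  classical
  rw [permList, markedMak_ofFn (oneLine π) fun i => Nat.succ_pos _, mak, Dbot, Res]
  congr 1
  · rw [Finset.sum_filter]
    refine Finset.sum_congr rfl fun j _ => ?_
    rw [value_oneLine]
    exact if_congr (cons_zero_castSucc _ (fun x => oneLine π j < x) (Nat.not_lt_zero _) j).symm
      rfl rfl
  · refine Finset.sum_congr rfl fun i _ => ?_
    rw [embracing_eq, Finset.card_filter]

/-! ### Kadell's bijection -/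

/-- Moves `z`, and then in turn each letter of the list that satisfies `P`, to the right across the
letters that do not satisfy `P`, up to the place before the next letter with `P`. -/
def carry (P : ℕ → Bool) : ℕ → List ℕ → List ℕ
  | z, [] => [z]
  | z, a :: l => if P a then z :: carry P a l else a :: carry P z l

/-- The factor rotation in Foata's second fundamental transformation, for words that are read from
right to left: the word is cut in front of each letter that lies on the same side of `x` as the
first one, and the first letter of each factor is moved to the end of that factor. -/
def rotate (x : ℕ) : List ℕ → List ℕ
  | [] => []
  | z :: l => if x < z then carry (fun a => x < a) z l else carry (fun a => a ≤ x) z l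

/-- Kadell's bijection, for words that are read from right to left: Foata's second fundamental
transformation in which the `s` letters next to the new letter `x` are left alone. -/
def kadell (s : ℕ) : List ℕ → List ℕ
  | [] => []
  | x :: u => x :: ((kadell s u).take s ++ rotate x ((kadell s u).drop s))

/-- The number of inversions of a word that is read from right to left. -/
def revInv : List ℕ → ℕ
  | [] => 0
  | x :: u => u.countP (x < ·) + revInv u

/-- The length of the list if its first entry exceeds `x`, and `0` otherwise. -/
def headWeight (x : ℕ) : List ℕ → ℕ
  | [] => 0
  | z :: l => if x < z then l.length + 1 else 0

/-- The statistic `invr (s + 1)` of a word that is read from right to left. -/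
def revInvr (s : ℕ) : List ℕ → ℕ
  | [] => 0
  | x :: u => (u.take s).countP (x < ·) + headWeight x (u.drop s) + revInvr s u

/-- The number of right-to-left minima below `B` of a word that is read from right to left. -/
def revMin : ℕ → List ℕ → ℕ
  | _, [] => 0
  | B, x :: u => if x < B then 1 + revMin x u else revMin B u

lemma carry_perm (P : ℕ → Bool) (z : ℕ) (l : List ℕ) : (carry P z l).Perm (z :: l) := by
  induction l generalizing z with
  | nil => exact .refl _
  | cons a l ih =>
    rw [carry]
    split_ifs
    · exact (ih a).cons z
    · exact ((ih z).cons a).trans (.swap _ _ _)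

lemma rotate_perm (x : ℕ) (v : List ℕ) : (rotate x v).Perm v := by
  cases v with
  | nil => exact .refl _
  | cons z l => rw [rotate]; split_ifs <;> exact carry_perm _ _ _

lemma take_append_rotate_perm (s x : ℕ) (v : List ℕ) :
    (v.take s ++ rotate x (v.drop s)).Perm v := by
  have := (rotate_perm x (v.drop s)).append_left (v.take s)
  rwa [List.take_append_drop] at this

lemma kadell_perm (s : ℕ) (l : List ℕ) : (kadell s l).Perm l := by
  induction l with
  | nil => exact .refl _
  | cons x u ih =>
    rw [kadell]
    exact ((take_append_rotate_perm s x _).trans ih).cons x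

lemma carry_getLast (P : ℕ → Bool) {z : ℕ} (hz : P z) (l : List ℕ) :
    ∃ y, (carry P z l).getLast? = some y ∧ P y := by
  induction l generalizing z with
  | nil => exact ⟨z, rfl, hz⟩
  | cons a l ih =>
    rw [carry]
    split_ifs with ha
    · obtain ⟨y, h, hy⟩ := ih ha
      exact ⟨y, by simp [List.getLast?_cons, h], hy⟩
    · obtain ⟨y, h, hy⟩ := ih hz
      exact ⟨y, by simp [List.getLast?_cons, h], hy⟩

lemma carry_injective (P : ℕ → Bool) {z z' : ℕ} (hz : P z) (hz' : P z') {l l' : List ℕ}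
    (h : carry P z l = carry P z' l') : z :: l = z' :: l' := by
  induction l generalizing z z' l' with
  | nil =>
    have := (carry_perm P z' l').length_eq
    rw [← h] at this
    cases l' with
    | nil => simpa [carry] using h
    | cons => simp [carry] at this
  | cons a l ih =>
    cases l' with
    | nil =>
      have := (carry_perm P z (a :: l)).length_eq
      rw [h] at this
      simp [carry] at this
    | cons a' l' =>
      simp only [carry] at h
      split_ifs at h with ha ha' ha' <;> obtain ⟨h1, h2⟩ := List.cons.inj h
      · rw [h1, ih ha ha' h2]
      · exact absurd (h1 ▸ hz) ha'
      · exact absurd (h1 ▸ hz') ha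
      · have := List.cons.inj (ih hz hz' h2)
        rw [h1, this.1, this.2]

lemma rotate_injective (x : ℕ) : Function.Injective (rotate x) := by
  -- The last letter of the rotated list tells on which side of `x` the first letter was.
  have side {z z' : ℕ} (hz : x < z) (hz' : ¬ x < z') (l l' : List ℕ) :
      carry (fun a => x < a) z l ≠ carry (fun a => a ≤ x) z' l' := by
    intro h
    obtain ⟨y, hy, h1⟩ := carry_getLast (fun a => x < a) (by simpa using hz) l
    obtain ⟨y', hy', h2⟩ := carry_getLast (fun a => a ≤ x) (by simpa using hz') l'
    rw [h, hy'] at hy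
    cases hy
    simp only [decide_eq_true_eq] at h1 h2
    omega
  intro v v' h
  have hlen := (rotate_perm x v).length_eq.symm.trans (h ▸ (rotate_perm x v').length_eq)
  rcases v with _ | ⟨z, l⟩ <;> rcases v' with _ | ⟨z', l'⟩
  · rfl
  · simp at hlen
  · simp at hlen
  · simp only [rotate] at h
    split_ifs at h with h1 h2 h2
    · exact carry_injective _ (by simpa using h1) (by simpa using h2) h
    · exact absurd h (side h1 h2 _ _)
    · exact absurd h.symm (side h2 h1 _ _)
    · exact carry_injective _ (by simpa using h1) (by simpa using h2) h

lemma kadell_injective (s : ℕ) : Function.Injective (kadell s) := by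
  intro l
  induction l with
  | nil =>
    intro l' h
    have hp := kadell_perm s l'
    rw [← h] at hp
    exact (List.nil_perm.1 hp).symm
  | cons x u ih =>
    intro l' h
    cases l' with
    | nil => simp [kadell] at h
    | cons x' u' =>
      rw [kadell, kadell] at h
      obtain ⟨rfl, h⟩ := List.cons.inj h
      have hlen := congrArg List.length h
      rw [(take_append_rotate_perm s x _).length_eq, (take_append_rotate_perm s x _).length_eq]
        at hlen
      obtain ⟨h1, h2⟩ := List.append_inj h (by simp [hlen])
      rw [ih (a₂ := u')]
      rw [← List.take_append_drop s (kadell s u), h1, rotate_injective _ h2,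
        List.take_append_drop]

lemma filter_carry {P q : ℕ → Bool} {z : ℕ} (hz : P z)
    (h : (∀ a, q a → P a) ∨ ∀ a, q a → ¬ P a) (l : List ℕ) :
    (carry P z l).filter q = (z :: l).filter q := by
  induction l generalizing z with
  | nil => rfl
  | cons a l ih =>
    rw [carry]
    split_ifs with ha
    · rw [List.filter_cons, ih ha, ← List.filter_cons]
    · rw [List.filter_cons, ih hz]
      rcases h with h | h
      · have : ¬ q a := fun hq => ha (h a hq)
        simp [List.filter_cons, this]
      · have : ¬ q z := fun hq => h z hq hz
        simp [List.filter_cons, this]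

/-- The rotation preserves the relative order of the letters on either side of `x`. -/
lemma filter_rotate {x : ℕ} {q : ℕ → Bool} (h : (∀ a, q a → a ≤ x) ∨ ∀ a, q a → x < a)
    (v : List ℕ) : (rotate x v).filter q = v.filter q := by
  cases v with
  | nil => rfl
  | cons z l =>
    rw [rotate]
    split_ifs with hz
    · exact filter_carry (by simpa using hz) (by simpa using h.symm) l
    · exact filter_carry (by simpa using hz) (by simpa using h) l

lemma filter_take_append_rotate {x : ℕ} {q : ℕ → Bool}
    (h : (∀ a, q a → a ≤ x) ∨ ∀ a, q a → x < a) (s : ℕ) (v : List ℕ) :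
    (v.take s ++ rotate x (v.drop s)).filter q = v.filter q := by
  rw [List.filter_append, filter_rotate h, ← List.filter_append, List.take_append_drop]

/-- The relative order of `v` and `v + 1` does not change: they lie on the same side of any other
letter `x`. -/
lemma filter_kadell (s v : ℕ) {l : List ℕ} (hl : l.Nodup) :
    (kadell s l).filter (fun a => a = v ∨ a = v + 1) = l.filter fun a => a = v ∨ a = v + 1 := by
  induction l with
  | nil => rfl
  | cons x u ih =>
    rw [List.nodup_cons] at hl
    rw [kadell, List.filter_cons, List.filter_cons]
    by_cases hx : x = v ∨ x = v + 1
    · -- Only one further letter can satisfy the condition.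
      have hperm := (((kadell_perm s (x :: u)).cons_inv).filter fun a => decide (a = v ∨ a = v + 1))
      have hlen : (u.filter fun a => decide (a = v ∨ a = v + 1)).length ≤ 1 := by
        let y := if x = v then v + 1 else v
        have hsub : (u.filter fun a => decide (a = v ∨ a = v + 1)) ⊆ [y] := by
          intro a ha
          simp only [List.mem_filter, decide_eq_true_eq] at ha
          have : a ≠ x := fun h => hl.1 (h ▸ ha.1)
          simp only [y, List.mem_singleton]
          split_ifs <;> omega
        simpa using (List.subperm_of_subset (hl.2.filter _) hsub).length_le
      have heq : ((kadell s u).take s ++ rotate x ((kadell s u).drop s)).filter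
          (fun a => decide (a = v ∨ a = v + 1)) = u.filter fun a => decide (a = v ∨ a = v + 1) := by
        generalize hL : u.filter (fun a => decide (a = v ∨ a = v + 1)) = L at hperm hlen
        rcases L with _ | ⟨b, _ | ⟨c, L⟩⟩
        · exact List.perm_nil.1 hperm
        · exact List.perm_singleton.1 hperm
        · simp at hlen
      rw [heq]
    · have hside : (∀ a, decide (a = v ∨ a = v + 1) = true → a ≤ x) ∨
          ∀ a, decide (a = v ∨ a = v + 1) = true → x < a := by
        simp only [decide_eq_true_eq]
        rcases lt_or_ge x v with h | h
        · right; omega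
        · left; omega
      rw [filter_take_append_rotate hside, ih hl.2]

lemma revMin_congr_filter {B : ℕ} {u v : List ℕ}
    (h : u.filter (· < B) = v.filter (· < B)) : revMin B u = revMin B v := by
  have key : ∀ (C : ℕ), C ≤ B → ∀ u : List ℕ, revMin C u = revMin C (u.filter (· < B)) := by
    intro C hC u
    induction u generalizing C with
    | nil => rfl
    | cons x u ih =>
      by_cases hx : x < B
      · rw [List.filter_cons_of_pos (by simpa using hx), revMin, revMin, ← ih x hx.le, ← ih C hC]
      · rw [List.filter_cons_of_neg (by simpa using hx), revMin, if_neg (by omega), ih C hC]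
  rw [key B le_rfl u, key B le_rfl v, h]

lemma kadell_take (s : ℕ) (l : List ℕ) : (kadell s l).take (s + 1) = l.take (s + 1) := by
  induction l with
  | nil => rfl
  | cons x u ih =>
    rw [kadell, List.take_succ_cons, List.take_succ_cons]
    congr 1
    have h1 : (kadell s u).take s = u.take s := by
      have := congrArg (List.take s) ih
      simpa [List.take_take] using this
    rw [← h1]
    rcases le_total s (kadell s u).length with h | h
    · exact List.take_left' (by simp [h])
    · simp [List.drop_eq_nil_of_le h, rotate, List.take_take]

lemma revInv_carry_gt {x z : ℕ} (hz : x < z) (l : List ℕ) :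
    revInv (carry (fun a => x < a) z l) = revInv (z :: l) + l.countP (· ≤ x) := by
  induction l generalizing z with
  | nil => simp [carry]
  | cons a l ih =>
    rw [carry]
    split_ifs with ha
    · have ha : x < a := by simpa using ha
      rw [revInv, (carry_perm _ a l).countP_eq, ih ha,
        List.countP_cons_of_neg (p := fun b => decide (b ≤ x)) (by simpa using ha), ← add_assoc]
      rfl
    · have ha : a ≤ x := by simpa using ha
      rw [revInv, (carry_perm _ z l).countP_eq, ih hz,
        List.countP_cons_of_pos (a := a) (by simpa using ha),
        List.countP_cons_of_pos (by simp; omega)]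
      simp only [revInv]
      rw [List.countP_cons_of_neg (by simp; omega)]
      ring

lemma revInv_carry_le {x z : ℕ} (hz : z ≤ x) (l : List ℕ) :
    revInv (carry (fun a => a ≤ x) z l) + l.countP (x < ·) = revInv (z :: l) := by
  induction l generalizing z with
  | nil => simp [carry]
  | cons a l ih =>
    rw [carry]
    split_ifs with ha
    · have ha : a ≤ x := by simpa using ha
      rw [revInv, (carry_perm _ a l).countP_eq,
        List.countP_cons_of_neg (p := fun b => decide (x < b)) (by simpa using ha), add_assoc,
        ih ha]
      rfl
    · have ha : x < a := by simpa using ha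
      rw [revInv, (carry_perm _ z l).countP_eq,
        List.countP_cons_of_pos (p := fun b => decide (x < b)) (by simpa using ha),
        List.countP_cons_of_neg (by simp; omega)]
      have := ih hz
      simp only [revInv] at this ⊢
      rw [List.countP_cons_of_pos (by simp; omega)]
      omega

lemma revInv_rotate (x : ℕ) (v : List ℕ) :
    revInv (rotate x v) + v.countP (x < ·) = revInv v + headWeight x v := by
  cases v with
  | nil => rfl
  | cons z l =>
    rw [rotate, headWeight]
    split_ifs with hz
    · rw [revInv_carry_gt hz, List.countP_cons_of_pos (by simpa using hz),
        List.length_eq_countP_add_countP (· ≤ x) (l := l)]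
      simp only [decide_eq_true_eq, not_le]
      ring
    · rw [← revInv_carry_le (not_lt.1 hz) l, List.countP_cons_of_neg (by simpa using hz), add_zero]

lemma revInv_append_perm (a : List ℕ) {b c : List ℕ} (h : b.Perm c) :
    revInv (a ++ b) + revInv c = revInv (a ++ c) + revInv b := by
  induction a with
  | nil => simp [add_comm]
  | cons x a ih =>
    simp only [List.cons_append, revInv, (h.append_left a).countP_eq]
    omega

lemma headWeight_congr {x : ℕ} {u v : List ℕ} (h : u.take 1 = v.take 1)
    (hlen : u.length = v.length) : headWeight x u = headWeight x v := by
  cases u <;> cases v <;> simp_all [headWeight]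

/-- Kadell's bijection takes `invr` to `inv`. -/
theorem revInv_kadell (s : ℕ) (l : List ℕ) : revInv (kadell s l) = revInvr s l := by
  induction l with
  | nil => rfl
  | cons x u ih =>
    have htake := kadell_take s u
    have hlen := (kadell_perm s u).length_eq
    have h1 : (kadell s u).take s = u.take s := by
      have := congrArg (List.take s) htake
      simpa [List.take_take] using this
    have h2 : headWeight x ((kadell s u).drop s) = headWeight x (u.drop s) := by
      refine headWeight_congr ?_ (by simp [hlen])
      have := congrArg (List.drop s) htake
      simpa [List.drop_take] using this
    rw [kadell, revInv, revInvr, List.countP_append, (rotate_perm x _).countP_eq, ← ih, ← h2, ← h1]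
    have h3 := revInv_rotate x ((kadell s u).drop s)
    have h4 := revInv_append_perm ((kadell s u).take s) (rotate_perm x ((kadell s u).drop s))
    rw [List.take_append_drop] at h4
    omega

/-- The right-to-left minima to the left of `x` are those of the subword of the letters below `x`,
which the rotation preserves. -/
lemma revMin_kadell (s B : ℕ) (l : List ℕ) : revMin B (kadell s l) = revMin B l := by
  induction l generalizing B with
  | nil => rfl
  | cons x u ih =>
    rw [kadell, revMin, revMin]
    have h (C : ℕ) (hC : C ≤ x) :
        revMin C ((kadell s u).take s ++ rotate x ((kadell s u).drop s)) = revMin C u := by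
      rw [← ih C]
      refine revMin_congr_filter (filter_take_append_rotate (.inl fun a ha => ?_) s _)
      have : a < C := by simpa using ha
      omega
    split_ifs with hx
    · rw [h x le_rfl]
    · rw [h B (not_lt.1 hx)]

/-! ### Words read from right to left -/

lemma listInv_append_singleton (l : List ℕ) (x : ℕ) :
    listInv (l ++ [x]) = l.countP (x < ·) + listInv l := by
  induction l with
  | nil => rfl
  | cons y l ih =>
    simp only [List.cons_append, listInv, ih, List.countP_append, List.countP_cons]
    simp
    ring

lemma listInv_reverse (l : List ℕ) : listInv l.reverse = revInv l := by
  induction l with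
  | nil => rfl
  | cons x u ih =>
    rw [List.reverse_cons, listInv_append_singleton, ih, revInv, List.countP_reverse]

/-- The number of right-to-left minima below `B` of a list. -/
def rlminBelow (B : ℕ) : List ℕ → ℕ
  | [] => 0
  | x :: l => (if x < B ∧ ∀ y ∈ l, x < y then 1 else 0) + rlminBelow B l

lemma rlminBelow_append_singleton (B x : ℕ) (l : List ℕ) :
    rlminBelow B (l ++ [x]) = if x < B then 1 + rlminBelow x l else rlminBelow B l := by
  induction l with
  | nil => simp [rlminBelow]
  | cons y l ih =>
    have h : (y < B ∧ ∀ z ∈ l ++ [x], y < z) ↔ y < min B x ∧ ∀ z ∈ l, y < z := by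
      simp only [List.mem_append, List.mem_singleton, or_imp, forall_and, forall_eq, lt_min_iff]
      tauto
    simp only [List.cons_append, rlminBelow, ih, h]
    by_cases hx : x < B
    · simp only [if_pos hx, min_eq_right hx.le]
      ring
    · simp only [if_neg hx, min_eq_left (not_lt.1 hx)]

lemma rlminBelow_reverse (B : ℕ) (l : List ℕ) : rlminBelow B l.reverse = revMin B l := by
  induction l generalizing B with
  | nil => rfl
  | cons x u ih => rw [List.reverse_cons, rlminBelow_append_singleton, revMin, ih, ih]

lemma rlminBelow_eq_rlmin {B : ℕ} {l : List ℕ} (h : ∀ y ∈ l, y < B) :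
    rlminBelow B l = rlmin l := by
  induction l with
  | nil => rfl
  | cons x l ih =>
    simp only [List.mem_cons, forall_eq_or_imp] at h
    simp only [rlminBelow, rlmin, ih h.2, h.1, true_and]

lemma countP_take_reverse_ofFn {n : ℕ} (w : Fin n → ℕ) (s : ℕ) (p : ℕ → Bool) :
    ((List.ofFn w).reverse.take s).countP p =
      ∑ i : Fin n, if n < i + (s + 1) ∧ p (w i) then 1 else 0 := by
  induction n generalizing s with
  | zero => simp
  | succ n ih =>
    rw [List.ofFn_succ', List.concat_eq_append, List.reverse_append, List.reverse_singleton,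
      List.singleton_append, Fin.sum_univ_castSucc]
    cases s with
    | zero =>
      have h (i : Fin n) : ¬ n + 1 < (i : ℕ) + 1 := by omega
      simp [h]
    | succ s =>
      have h (i : Fin n) : n + 1 < (i : ℕ) + (s + 1 + 1) ↔ n < (i : ℕ) + (s + 1) := by omega
      rw [List.take_succ_cons, List.countP_cons, ih]
      simp [h]

lemma headWeight_drop_reverse_ofFn {n : ℕ} (w : Fin n → ℕ) (s x : ℕ) :
    headWeight x ((List.ofFn w).reverse.drop s) =
      ∑ i : Fin n, if n = i + (s + 1) ∧ x < w i then (i : ℕ) + 1 else 0 := by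
  induction n generalizing s with
  | zero => simp [headWeight]
  | succ n ih =>
    rw [List.ofFn_succ', List.concat_eq_append, List.reverse_append, List.reverse_singleton,
      List.singleton_append, Fin.sum_univ_castSucc]
    cases s with
    | zero =>
      have h (i : Fin n) : ¬ n = (i : ℕ) := by omega
      simp [h, headWeight]
    | succ s =>
      have h (i : Fin n) : n + 1 = (i : ℕ) + (s + 1 + 1) ↔ n = (i : ℕ) + (s + 1) := by omega
      rw [List.drop_succ_cons, ih]
      simp [h]

lemma invr_eq_revInvr (s : ℕ) {n : ℕ} (w : Fin n → ℕ) :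
    invr (s + 1) w = revInvr s (List.ofFn w).reverse := by
  have h : invr (s + 1) w =
      (∑ i : Fin n, ∑ j : Fin n, if i < j ∧ (j : ℕ) < i + (s + 1) ∧ w j < w i then 1 else 0) +
        ∑ i : Fin n, if ∃ j : Fin n, (j : ℕ) = i + (s + 1) ∧ w j < w i then (i : ℕ) + 1 else 0 := by
    rw [invr, Finset.card_filter, Fintype.sum_prod_type, Finset.sum_filter]
  rw [h]
  clear h
  induction n with
  | zero => simp [revInvr]
  | succ n ih =>
    rw [List.ofFn_succ', List.concat_eq_append, List.reverse_append, List.reverse_singleton,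
      List.singleton_append, revInvr, ← ih, countP_take_reverse_ofFn, headWeight_drop_reverse_ofFn]
    have h1 (i : Fin n) : Fin.castSucc i < Fin.last n := Fin.castSucc_lt_last i
    have h2 (i : Fin n) : ¬ Fin.last n < Fin.castSucc i := (h1 i).not_gt
    -- At most one of the two witnesses exists, as `n` is not the value of an index in `Fin n`.
    have h3 (i : Fin n) : (if ∃ j : Fin (n + 1), (j : ℕ) = (i : ℕ) + (s + 1) ∧
          w j < w i.castSucc then (i : ℕ) + 1 else 0) =
        (if n = (i : ℕ) + (s + 1) ∧ w (Fin.last n) < w i.castSucc then (i : ℕ) + 1 else 0) +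
        if ∃ j : Fin n, (j : ℕ) = (i : ℕ) + (s + 1) ∧ w j.castSucc < w i.castSucc
          then (i : ℕ) + 1 else 0 := by
      simp only [Fin.exists_fin_succ', Fin.val_castSucc, Fin.val_last]
      by_cases hn : n = (i : ℕ) + (s + 1)
      · have : ¬ ∃ j : Fin n, (j : ℕ) = (i : ℕ) + (s + 1) ∧ w j.castSucc < w i.castSucc := by
          rintro ⟨j, hj, -⟩
          omega
        simp [this]
      · have : ¬ (n = (i : ℕ) + (s + 1) ∧ w (Fin.last n) < w i.castSucc) := fun h => hn h.1
        simp [this]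
    have h4 : ¬ ∃ j : Fin (n + 1), (j : ℕ) = n + (s + 1) ∧ w j < w (Fin.last n) := by
      rintro ⟨j, hj, -⟩
      omega
    simp only [Fin.sum_univ_castSucc (n := n), Fin.val_castSucc, h3, h1, h2, h4, Fin.val_last,
      Fin.castSucc_lt_castSucc_iff, lt_irrefl, false_and, if_false, true_and,
      Finset.sum_add_distrib, decide_eq_true_eq, Finset.sum_const_zero, add_zero]
    ring

/-! ### Kadell's bijection on permutations with a prescribed inverse descent set -/

section KadellSums

variable {R : Type*} [CommRing R]

/-- Kadell's bijection on lists that are read from left to right. -/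
def kadellList (s : ℕ) (l : List ℕ) : List ℕ := (kadell s l.reverse).reverse

lemma kadellList_perm (s : ℕ) (l : List ℕ) : (kadellList s l).Perm l :=
  (List.reverse_perm _).trans ((kadell_perm s _).trans (List.reverse_perm l))

lemma kadellList_injective (s : ℕ) : Function.Injective (kadellList s) :=
  List.reverse_injective.comp ((kadell_injective s).comp List.reverse_injective)

lemma listInv_kadellList (s : ℕ) (l : List ℕ) : listInv (kadellList s l) = revInvr s l.reverse := by
  rw [kadellList, listInv_reverse, revInv_kadell]

lemma rlmin_kadellList (s : ℕ) (l : List ℕ) : rlmin (kadellList s l) = rlmin l := by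
  obtain ⟨B, hB⟩ : ∃ B, ∀ y ∈ l, y < B :=
    ⟨l.sum + 1, fun y hy => Nat.lt_succ_of_le (List.single_le_sum (by simp) y hy)⟩
  rw [← rlminBelow_eq_rlmin hB,
    ← rlminBelow_eq_rlmin fun y hy => hB y ((kadellList_perm s l).mem_iff.1 hy), kadellList,
    rlminBelow_reverse, revMin_kadell, ← rlminBelow_reverse, List.reverse_reverse]

lemma invDesSubset_kadellList (S : Finset ℕ) (N s : ℕ) {l : List ℕ} (hl : l.Nodup) :
    InvDesSubset S N (kadellList s l) ↔ InvDesSubset S N l := by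
  have h : ∀ v, [v, v + 1].Sublist (kadellList s l) ↔ [v, v + 1].Sublist l := by
    intro v
    have hp : ∀ x ∈ [v, v + 1], decide (x = v ∨ x = v + 1) = true := by simp
    rw [sublist_iff_sublist_filter _ hp, sublist_iff_sublist_filter (l := l) _ hp, kadellList,
      List.filter_reverse, filter_kadell s v (List.nodup_reverse.2 hl), List.filter_reverse,
      List.reverse_reverse]
  simp only [InvDesSubset, h]

lemma map_kadellList_perm (s N : ℕ) :
    ((List.permutations' (descList N)).map (kadellList s)).Perm
      (List.permutations' (descList N)) := by
  refine (List.subperm_of_subset ((nodup_permutations_descList N).map (kadellList_injective s))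
    fun l hl => ?_).perm_of_length_le (by simp)
  obtain ⟨l', hl', rfl⟩ := List.mem_map.1 hl
  rw [List.mem_permutations'] at hl' ⊢
  exact (kadellList_perm s l').trans hl'

open Classical in
/-- The statistics `(invr, rlmin)` and `(inv, rlmin)` have the same generating function on the
permutations of `1, …, N` with `InvDesSubset S N`. -/
theorem sum_revInvr_eq_sum_listInv (q t : R) (S : Finset ℕ) (N s : ℕ) :
    ((List.permutations' (descList N)).map fun l => if InvDesSubset S N l then
      q ^ revInvr s l.reverse * t ^ rlmin l else 0).sum =
    ((List.permutations' (descList N)).map fun l => if InvDesSubset S N l then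
      q ^ listInv l * t ^ rlmin l else 0).sum := by
  rw [← ((map_kadellList_perm s N).map fun l => if InvDesSubset S N l then
      q ^ listInv l * t ^ rlmin l else 0).sum_eq, List.map_map]
  refine congrArg List.sum (List.map_congr_left fun l hl => ?_)
  have hl : l.Nodup := (List.mem_permutations'.1 hl).nodup_iff.2 (nodup_descList N)
  simp only [Function.comp_apply, invDesSubset_kadellList S N s hl, listInv_kadellList,
    rlmin_kadellList]

end KadellSums

/-! ### Equidistribution -/

section Equidistribution

variable {α : Type}

lemma Equidistributed.symm {β : Type} [DecidableEq β] {A : Finset α} {f g : α → β}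
    (h : Equidistributed A f g) : Equidistributed A g f := fun b => (h b).symm

open Polynomial in
lemma equidistributed_of_sum_eq (A : Finset α) (f g u : α → ℕ)
    (h : ∀ q t : ℤ[X][X], ∑ a ∈ A, q ^ f a * t ^ u a = ∑ a ∈ A, q ^ g a * t ^ u a) :
    Equidistributed A (fun a => (f a, u a)) fun a => (g a, u a) := by
  rintro ⟨x, y⟩
  -- For the two variables, the coefficients of the sums are the numbers to be compared.
  have key : ∀ f : α → ℕ, ((∑ a ∈ A, (C X : ℤ[X][X]) ^ f a * X ^ u a).coeff y).coeff x =
      ((A.filter fun a => (f a, u a) = (x, y)).card : ℤ) := by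
    intro f
    rw [finsetSum_coeff, finsetSum_coeff, Finset.card_filter, Nat.cast_sum]
    refine Finset.sum_congr rfl fun a _ => ?_
    rw [← C_pow, coeff_C_mul, coeff_X_pow, mul_ite, mul_one, mul_zero]
    by_cases hy : y = u a
    · simp [hy, coeff_X_pow, eq_comm]
    · simp [hy, Ne.symm hy]
  have := congrArg (fun p => (p.coeff y).coeff x) (h (C X) X)
  simp only [key] at this
  exact_mod_cast this

variable {β : Type} [DecidableEq β]

/-- Equidistribution on the sets `{h ⊆ S}` for all `S` gives equidistribution on the sets
`{h = S}`. -/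
lemma equidistributed_eq_of_subset (A : Finset α) (h : α → Finset ℕ) {f g : α → β}
    (H : ∀ S, Equidistributed (A.filter fun a => h a ⊆ S) f g) (S : Finset ℕ) :
    Equidistributed (A.filter fun a => h a = S) f g := by
  intro b
  induction S using Finset.strongInduction with
  | H S ih =>
    have key : ∀ f : α → β, ((A.filter fun a => h a ⊆ S).filter fun a => f a = b).card =
        (∑ T ∈ S.ssubsets, ((A.filter fun a => h a = T).filter fun a => f a = b).card) +
          ((A.filter fun a => h a = S).filter fun a => f a = b).card := by
      intro f
      rw [Finset.card_eq_sum_card_fiberwise (f := h) (t := S.powerset), ←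
        Finset.insert_erase (Finset.mem_powerset_self S), Finset.sum_insert (by simp), add_comm]
      · congr 1
        · refine Finset.sum_congr (by rfl) fun T hT => ?_
          congr 1
          ext a
          simp only [Finset.mem_filter]
          constructor
          · rintro ⟨⟨⟨h1, h2⟩, h3⟩, h4⟩
            exact ⟨⟨h1, h4⟩, h3⟩
          · rintro ⟨⟨h1, h4⟩, h3⟩
            exact ⟨⟨⟨h1, h4 ▸ (Finset.mem_ssubsets.1 hT).subset⟩, h3⟩, h4⟩
        · congr 1
          ext a
          simp only [Finset.mem_filter]
          constructor
          · rintro ⟨⟨⟨h1, h2⟩, h3⟩, h4⟩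
            exact ⟨⟨h1, h4⟩, h3⟩
          · rintro ⟨⟨h1, h4⟩, h3⟩
            exact ⟨⟨⟨h1, h4.le⟩, h3⟩, h4⟩
      · intro a ha
        simp only [Finset.coe_filter, Finset.mem_filter, Set.mem_ofPred_eq] at ha
        simpa using ha.1.2
    have h1 := H S b
    rw [key, key, Finset.sum_congr rfl fun T hT => ih T (Finset.mem_ssubsets.1 hT)] at h1
    exact Nat.add_left_cancel h1

end Equidistribution

section Permutations

variable {n : ℕ}

lemma equidistributed_permDesSubset {st : Equiv.Perm (Fin n) → ℕ} {lst : List ℕ → ℕ}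
    (hst : ∀ π, st π = lst (permList π⁻¹)) (S : Finset ℕ)
    (H : ∀ {R : Type} [CommRing R] (q t : R), open Classical in
      ((List.permutations' (descList n)).map fun l => if InvDesSubset S n l then
        q ^ lst l * t ^ rlmin l else 0).sum =
      ((List.permutations' (descList n)).map fun l => if InvDesSubset S n l then
        q ^ listInv l * t ^ rlmin l else 0).sum) :
    Equidistributed (permDesSubset n S) (fun π => (inv (oneLine π), lrmax (oneLine π)))
      fun π => (st π, lrmax (oneLine π)) := by
  classical
  refine equidistributed_of_sum_eq _ _ _ _ fun q t => ?_
  have key : ∀ (st : Equiv.Perm (Fin n) → ℕ) (lst : List ℕ → ℕ),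
      (∀ π, st π = lst (permList π⁻¹)) →
      ∑ π ∈ permDesSubset n S, q ^ st π * t ^ lrmax (oneLine π) =
        ((List.permutations' (descList n)).map fun l => if InvDesSubset S n l then
          q ^ lst l * t ^ rlmin l else 0).sum := by
    intro st lst hst
    rw [← sum_permList, ← Equiv.sum_comp (Equiv.inv _), permDesSubset, Finset.sum_filter]
    refine Finset.sum_congr rfl fun π _ => ?_
    simp only [Equiv.inv_apply, hst, lrmax_eq_rlmin, des_oneLine_subset_iff]
  rw [key st lst hst, key (fun π => inv (oneLine π)) listInv fun π => ?_, H]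
  rw [← inv_oneLine_inv, inv_eq_listInv, permList]

lemma equidistributed_triple {f g : Equiv.Perm (Fin n) → ℕ}
    (H : ∀ S, Equidistributed (permDesEq n S) (fun π => (f π, lrmax (oneLine π)))
      fun π => (g π, lrmax (oneLine π))) :
    Equidistributed (Finset.univ : Finset (Equiv.Perm (Fin n)))
      (fun π => (lrmax (oneLine π), des (oneLine π), f π))
      fun π => (lrmax (oneLine π), des (oneLine π), g π) := by
  rintro ⟨a, d, c⟩
  have key : ∀ f : Equiv.Perm (Fin n) → ℕ,
      (Finset.univ.filter fun π => (lrmax (oneLine π), des (oneLine π), f π) = (a, d, c)).card =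
      ∑ S ∈ Finset.univ.image fun π : Equiv.Perm (Fin n) => Des (oneLine π), if S.card = d then
        ((permDesEq n S).filter fun π => (f π, lrmax (oneLine π)) = (c, a)).card else 0 := by
    intro f
    rw [Finset.card_eq_sum_card_fiberwise (f := fun π : Equiv.Perm (Fin n) => Des (oneLine π))
      (t := Finset.univ.image fun π : Equiv.Perm (Fin n) => Des (oneLine π)) (by
        intro π _
        simp)]
    refine Finset.sum_congr rfl fun S _ => ?_
    split_ifs with hS
    · congr 1
      ext π
      simp only [permDesEq, Finset.mem_filter, Finset.mem_univ, true_and, Prod.mk.injEq, des]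
      constructor
      · rintro ⟨⟨h1, h2, h3⟩, h4⟩
        exact ⟨h4, h3, h1⟩
      · rintro ⟨rfl, h3, h1⟩
        exact ⟨⟨h1, hS, h3⟩, rfl⟩
    · rw [Finset.card_eq_zero, Finset.filter_eq_empty_iff]
      intro π hπ h
      simp only [Finset.mem_filter, Finset.mem_univ, true_and, Prod.mk.injEq, des] at hπ
      exact hS (h ▸ hπ.2.1)
  rw [key, key]
  exact Finset.sum_congr rfl fun S _ => by rw [H S (c, a)]

lemma equidistributed_mak (S : Finset ℕ) :
    Equidistributed (permDesSubset n S) (fun π => (inv (oneLine π), lrmax (oneLine π)))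
      fun π => (istat mak π, lrmax (oneLine π)) :=
  equidistributed_permDesSubset (lst := fun l => markedMak 0 (unmarked l))
    (fun π => mak_oneLine π⁻¹) S fun q t => sum_markedMak_eq_sum_listInv q t S n

lemma equidistributed_invr {r : ℕ} (hr : 0 < r) (S : Finset ℕ) :
    Equidistributed (permDesSubset n S) (fun π => (inv (oneLine π), lrmax (oneLine π)))
      fun π => (istat (invr r) π, lrmax (oneLine π)) := by
  obtain ⟨s, rfl⟩ := Nat.exists_eq_succ_of_ne_zero hr.ne'
  exact equidistributed_permDesSubset (lst := fun l => revInvr s l.reverse)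
    (fun π => invr_eq_revInvr s (oneLine π⁻¹)) S
    fun q t => sum_revInvr_eq_sum_listInv q t S n s

lemma maj_eq_invr_one (w : Fin n → ℕ) : maj w = invr 1 w := by
  have h : (Finset.univ.filter fun p : Fin n × Fin n =>
      p.1 < p.2 ∧ (p.2 : ℕ) < p.1 + 1 ∧ w p.2 < w p.1) = ∅ := by
    rw [Finset.filter_eq_empty_iff]
    rintro p - ⟨h1, h2, -⟩
    simp only [Fin.lt_def] at h1
    omega
  rw [maj, invr, h, Finset.card_empty, zero_add, Des, Finset.sum_image]
  · rfl
  · intro i _ j _ hij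
    exact Fin.ext (Nat.succ_injective hij)

end Permutations

end WordStat

theorem corollary3p4 (n : ℕ) (hn : 0 < n) (r : ℕ) (hr : 0 < r) :
    -- the four triples on all permutations
    (WordStat.Equidistributed (Finset.univ : Finset (Equiv.Perm (Fin n)))
        (fun π => (WordStat.lrmax (WordStat.oneLine π), WordStat.des (WordStat.oneLine π),
          WordStat.inv (WordStat.oneLine π)))
        (fun π => (WordStat.lrmax (WordStat.oneLine π), WordStat.des (WordStat.oneLine π),
          WordStat.istat WordStat.maj π)) ∧
      WordStat.Equidistributed (Finset.univ : Finset (Equiv.Perm (Fin n)))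
        (fun π => (WordStat.lrmax (WordStat.oneLine π), WordStat.des (WordStat.oneLine π),
          WordStat.inv (WordStat.oneLine π)))
        (fun π => (WordStat.lrmax (WordStat.oneLine π), WordStat.des (WordStat.oneLine π),
          WordStat.istat WordStat.mak π)) ∧
      WordStat.Equidistributed (Finset.univ : Finset (Equiv.Perm (Fin n)))
        (fun π => (WordStat.lrmax (WordStat.oneLine π), WordStat.des (WordStat.oneLine π),
          WordStat.inv (WordStat.oneLine π)))
        (fun π => (WordStat.lrmax (WordStat.oneLine π), WordStat.des (WordStat.oneLine π),
          WordStat.istat (WordStat.invr r) π))) ∧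
    -- the four pairs on the permutations with a prescribed descent set, and with descent set
    -- contained in a prescribed set
    ∀ S : Finset ℕ, S ⊆ Finset.Icc 1 (n - 1) →
      ∀ D : Finset (Equiv.Perm (Fin n)),
        D = WordStat.permDesEq n S ∨ D = WordStat.permDesSubset n S →
          WordStat.Equidistributed D
            (fun π => (WordStat.inv (WordStat.oneLine π), WordStat.lrmax (WordStat.oneLine π)))
            (fun π => (WordStat.istat WordStat.maj π, WordStat.lrmax (WordStat.oneLine π))) ∧
          WordStat.Equidistributed D
            (fun π => (WordStat.inv (WordStat.oneLine π), WordStat.lrmax (WordStat.oneLine π)))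
            (fun π => (WordStat.istat WordStat.mak π, WordStat.lrmax (WordStat.oneLine π))) ∧
          WordStat.Equidistributed D
            (fun π => (WordStat.inv (WordStat.oneLine π), WordStat.lrmax (WordStat.oneLine π)))
            (fun π => (WordStat.istat (WordStat.invr r) π,
              WordStat.lrmax (WordStat.oneLine π))) := by
  have hmaj : (WordStat.istat WordStat.maj : Equiv.Perm (Fin n) → ℕ) =
      WordStat.istat (WordStat.invr 1) := funext fun π => WordStat.maj_eq_invr_one _
  rw [hmaj]
  have eq_of_subset {f : Equiv.Perm (Fin n) → ℕ}
      (H : ∀ S, WordStat.Equidistributed (WordStat.permDesSubset n S)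
        (fun π => (WordStat.inv (WordStat.oneLine π), WordStat.lrmax (WordStat.oneLine π)))
        fun π => (f π, WordStat.lrmax (WordStat.oneLine π))) (S : Finset ℕ) :
      WordStat.Equidistributed (WordStat.permDesEq n S)
        (fun π => (WordStat.inv (WordStat.oneLine π), WordStat.lrmax (WordStat.oneLine π)))
        fun π => (f π, WordStat.lrmax (WordStat.oneLine π)) :=
    WordStat.equidistributed_eq_of_subset _ _ H S
  have h1 := WordStat.equidistributed_invr (n := n) one_pos
  have hm := WordStat.equidistributed_mak (n := n)
  have hi := WordStat.equidistributed_invr (n := n) hr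
  refine ⟨⟨WordStat.equidistributed_triple (eq_of_subset h1),
    WordStat.equidistributed_triple (eq_of_subset hm),
    WordStat.equidistributed_triple (eq_of_subset hi)⟩, ?_⟩
  rintro S - D (rfl | rfl)
  · exact ⟨eq_of_subset h1 S, eq_of_subset hm S, eq_of_subset hi S⟩
  · exact ⟨h1 S, hm S, hi S⟩
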